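/- Let $n\ge 1$. On $\mathbb R^{2n}$ with coordinates $(x,p)$ use the Poisson bracket $\{f,g\}=\sum_i\big(\frac{\partial f}{\partial p_i}\frac{\partial g}{\partial x_i}-\frac{\partial f}{\partial x_i}\frac{\partial g}{\partial p_i}\big)$. Functions are called functionally independent if their differentials are linearly independent at every point of some open dense set. A family $(F_1,\dots,F_k;F_{k+1},\dots,F_{2n-k})$ of smooth real functions is called an integrable set with $k$ central elements $F_1,\dots,F_k$ if it is functionally independent and $\{F_i,F_j\}=0$ for all $1\le i\le k$, $1\le j\le 2n-k$. Put $I_i=\frac12(p_i^2+x_i^2)$ and $z_i=(x_i+\mathrm i p_i)/\sqrt2$. Partition $\{1,\dots,n\}$ into $u\geq 1$ nonempty groups $G_1,\dots,G_u$, and let $q_h=\sharp G_h$. Let $s_1,\dots,s_u$ be positive integers (not necessarily distinct), $\epsilon_i=\pm1$, and $l_i=\epsilon_i s_h$ for $i\in G_h$. Let $w_i=z_i$ if $\epsilon_i=1$ and $w_i=\bar z_i$ if $\epsilon_i=-1$, and define $$P_{ij}=\mathrm i(w_i\bar w_j-w_j\bar w_i),\qquad K_h=\sum_{i\in G_h}\epsilon_iI_i,\qquad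 W_h=\sum_{i\in G_h}\epsilon_iw_i^2 .$$ For $r,m\in\mathbb Z^u$ let $J_r=\sum_h r_hK_h$ and $R_m=\prod_{h:\,m_h\ge0}W_h^{m_h}\prod_{h:\,m_h<0}\bar W_h^{-m_h}$. For each $h$ let $z_h\in\{1,\dots,q_h-1\}$ if $q_h>1$, and $z_h=0$ if $q_h=1$; put $z=\sum_hz_h$. Call a pair $(Z,L)$ admissible for $h$ if $Z$ consists of $z_h$ and $L$ of $2(q_h-z_h-1)$ real polynomials of degree $\le2$ in the variables $P_{ij}$ ($i<j$, $i,j\in G_h$) such that, as functions on the phase space $\mathbb R^{2q_h}$ of the oscillators of $G_h$, the functions of $(Z,L)$ are functionally independent and every element of $Z$ is in involution with every element of $(Z,L)$. (If $q_h=1$ both are empty.) Let $1\le k'\le u$, let $r^{(1)},\dots,r^{(u)}\in\mathbb Z^u$ be linearly independent with $r^{(1)}=s=(s_1,\dots,s_u)$, and let $m^{(1)},\dots,m^{(u-k')}\in\mathbb Z^u$ be linearly independent with $r^{(i)}\cdot m^{(j)}=0$ for all $i\le k'$ and all $j$. Then for every $h$ an admissible pair exists. Moreover, for every choice of admissible pairs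 $(Z_h,L_h)$, $h=1,\dots,u$, the family $$F=(\mathcal J_1,\mathcal Z;\mathcal J_2,\mathcal R,\mathcal L),$$ where $$\mathcal J_1=(J_{r^{(1)}},\dots,J_{r^{(k')}}),\quad \mathcal J_2=(J_{r^{(k'+1)}},\dots,J_{r^{(u)}}),\quad \mathcal R=(\operatorname{Im}R_{m^{(1)}},\dots,\operatorname{Im}R_{m^{(u-k')}}),$$ $\mathcal Z=(Z_1,\dots,Z_u)$ and $\mathcal L=(L_1,\dots,L_u)$, evaluated at the momenta $P_{ij}$ on $\mathbb R^{2n}$, is an integrable set of $2n-k$ functions with the $k=k'+z$ central elements $(\mathcal J_1,\mathcal Z)$, and its first element is $J_{r^{(1)}}=\sum_{i=1}^nl_iI_i$. -/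

import Mathlib

open scoped ContDiff

noncomputable section

namespace Oscillators

/-- The phase space of oscillators indexed by `ι`: points are pairs `(x, p)`. -/
abbrev PhaseSpace (ι : Type) : Type := (ι → ℝ) × (ι → ℝ)

section General

variable {ι : Type} [Fintype ι] [DecidableEq ι]

/-- The derivative of `f` with respect to `x_i`. -/
def partialX (i : ι) (f : PhaseSpace ι → ℝ) (y : PhaseSpace ι) : ℝ :=
  fderiv ℝ f y (Pi.single i 1, 0)

/-- The derivative of `f` with respect to `p_i`. -/
def partialP (i : ι) (f : PhaseSpace ι → ℝ) (y : PhaseSpace ι) : ℝ :=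
  fderiv ℝ f y (0, Pi.single i 1)

/-- The Poisson bracket, with the sign convention `{p_i, x_j} = δ_ij`,
that is `{z_i, conj z_j} = i δ_ij`. -/
def poissonBracket (f g : PhaseSpace ι → ℝ) (y : PhaseSpace ι) : ℝ :=
  ∑ i, (partialP i f y * partialX i g y - partialX i f y * partialP i g y)

/-- Functional independence: the differentials are linearly independent
at every point of an open dense subset of phase space. -/
def FunctionallyIndependent {α : Type} (F : α → PhaseSpace ι → ℝ) : Prop :=
  ∃ U : Set (PhaseSpace ι), IsOpen U ∧ Dense U ∧
    ∀ y ∈ U, LinearIndependent ℝ (fun a => fderiv ℝ (F a) y)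

/-- The family `(C; D)` is an integrable set with the `k` central elements `C`: it consists of
`2 n - k` smooth functionally independent functions, where `n` is the number of degrees of
freedom, and the `k` functions `C` are in involution with all functions of the family. -/
structure IsIntegrableSet (k : ℕ) {α β : Type} [Fintype α] [Fintype β]
    (C : α → PhaseSpace ι → ℝ) (D : β → PhaseSpace ι → ℝ) : Prop where
  card_central : Fintype.card α = k
  card_total : Fintype.card α + Fintype.card β + k = 2 * Fintype.card ι
  smooth : ∀ a, ContDiff ℝ ∞ (Sum.elim C D a)
  independent : FunctionallyIndependent (Sum.elim C D)
  involution : ∀ a b, poissonBracket (C a) (Sum.elim C D b) = 0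

/-- The action `I_i = (p_i² + x_i²) / 2`. -/
def action (i : ι) (y : PhaseSpace ι) : ℝ := (y.2 i ^ 2 + y.1 i ^ 2) / 2

/-- The Hamiltonian `∑ l_i I_i` of linear oscillators with frequencies `l`. -/
def linearHamiltonian (l : ι → ℤ) (y : PhaseSpace ι) : ℝ := ∑ i, (l i : ℝ) * action i y

/-- `z_j = (x_j + i p_j) / √2`. -/
def zCoord (j : ι) (y : PhaseSpace ι) : ℂ :=
  ((y.1 j : ℂ) + Complex.I * (y.2 j : ℂ)) / ((Real.sqrt 2 : ℝ) : ℂ)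

/-- `w_j` is `z_j` if `ε_j = 1` and the conjugate of `z_j` if `ε_j = -1`. -/
def wCoord (ε : ι → ℤˣ) (j : ι) (y : PhaseSpace ι) : ℂ :=
  if ε j = 1 then zCoord j y else star (zCoord j y)

/-- `P_ij = i (w_i conj(w_j) - w_j conj(w_i))`; the complex number in parentheses is real. -/
def momentum (ε : ι → ℤˣ) (i j : ι) (y : PhaseSpace ι) : ℝ :=
  (Complex.I * (wCoord ε i y * star (wCoord ε j y) - wCoord ε j y * star (wCoord ε i y))).re

/-- The pairs `(i, j)` with `i < j`, which index the momenta `P_ij`. -/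
abbrev Pairs (κ : Type) [LinearOrder κ] : Type := {ij : κ × κ // ij.1 < ij.2}

/-- The value of a polynomial `Q` in the variables `P_ij`, `i < j`, `i, j ∈ κ`, at the momenta of
the oscillators `e i`, `i ∈ κ`. -/
def evalMomenta (ε : ι → ℤˣ) {κ : Type} [LinearOrder κ] (e : κ → ι)
    (Q : MvPolynomial (Pairs κ) ℝ) (y : PhaseSpace ι) : ℝ :=
  MvPolynomial.eval (fun ij : Pairs κ => momentum ε (e ij.1.1) (e ij.1.2) y) Q

end General

/-- `(Z, L)` is an admissible pair of sets `Z_{q,z}`, `L_{q,z}` for the `q` oscillators indexed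
by `κ` with signs `ε`: `Z` consists of `z` and `L` of `2 (q - z - 1)` polynomials of degree at
most two in the momenta, the functions `(Z, L)` on the phase space of these oscillators are
functionally independent, and those of `Z` are in involution with all of them. -/
structure IsAdmissiblePair {κ : Type} [Fintype κ] [LinearOrder κ] (ε : κ → ℤˣ) (z : ℕ)
    (Z : Fin z → MvPolynomial (Pairs κ) ℝ)
    (L : Fin (2 * (Fintype.card κ - z - 1)) → MvPolynomial (Pairs κ) ℝ) : Prop where
  degree_Z : ∀ a, (Z a).totalDegree ≤ 2
  degree_L : ∀ b, (L b).totalDegree ≤ 2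
  independent : FunctionallyIndependent (fun c => evalMomenta ε id (Sum.elim Z L c))
  involution : ∀ a c,
    poissonBracket (evalMomenta ε id (Z a)) (evalMomenta ε id (Sum.elim Z L c)) = 0

section Groups

variable {n u : ℕ} (ε : Fin n → ℤˣ) (g : Fin n → Fin u)

/-- The oscillators of the `h`-th group. -/
abbrev Group (h : Fin u) : Type := {i : Fin n // g i = h}

/-- The number `q_h` of oscillators of the `h`-th group. -/
abbrev groupSize (h : Fin u) : ℕ := Fintype.card (Group g h)

/-- `K_h`, the sum of `ε_i I_i` over the `h`-th group. -/
def groupK (h : Fin u) (y : PhaseSpace (Fin n)) : ℝ :=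
  ∑ i : Group g h, ((ε i : ℤ) : ℝ) * action i.1 y

/-- `W_h`, the sum of `ε_i w_i²` over the `h`-th group. -/
def groupW (h : Fin u) (y : PhaseSpace (Fin n)) : ℂ :=
  ∑ i : Group g h, ((ε i : ℤ) : ℂ) * wCoord ε i.1 y ^ 2

/-- `J_r = ∑ r_h K_h`. -/
def groupJ (r : Fin u → ℤ) (y : PhaseSpace (Fin n)) : ℝ :=
  ∑ h, (r h : ℝ) * groupK ε g h y

/-- `R_m`, the product of the `W_h ^ m_h` with `m_h ≥ 0` and the `conj(W_h) ^ (-m_h)` with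
`m_h < 0`. -/
def groupR (m : Fin u → ℤ) (y : PhaseSpace (Fin n)) : ℂ :=
  ∏ h, if 0 ≤ m h then groupW ε g h y ^ (m h).toNat
    else star (groupW ε g h y) ^ (-m h).toNat

/-- The family `(𝒥₁, 𝒵)`. -/
def centralFamily (r : Fin u → Fin u → ℤ) (k' : ℕ) (z : Fin u → ℕ)
    (Z : ∀ h, Fin (z h) → MvPolynomial (Pairs (Group g h)) ℝ) :
    {i : Fin u // i.val < k'} ⊕ ((h : Fin u) × Fin (z h)) → PhaseSpace (Fin n) → ℝ :=
  Sum.elim (fun i => groupJ ε g (r i.1))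
    (fun a => evalMomenta ε Subtype.val (Z a.1 a.2))

/-- The family `(𝒥₂, ℛ, ℒ)`. -/
def otherFamily (r : Fin u → Fin u → ℤ) (k' : ℕ) (m : Fin (u - k') → Fin u → ℤ) (z : Fin u → ℕ)
    (L : ∀ h, Fin (2 * (groupSize g h - z h - 1)) → MvPolynomial (Pairs (Group g h)) ℝ) :
    {i : Fin u // k' ≤ i.val} ⊕
      (Fin (u - k') ⊕ ((h : Fin u) × Fin (2 * (groupSize g h - z h - 1)))) →
      PhaseSpace (Fin n) → ℝ :=
  Sum.elim (fun i => groupJ ε g (r i.1))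
    (Sum.elim (fun j y => (groupR ε g (m j) y).im)
      (fun b => evalMomenta ε Subtype.val (L b.1 b.2)))

end Groups

end Oscillators

end

/-! Within a group the momenta act as infinitesimal pseudo-orthogonal transformations for the form
`∑ ε_k x_k²`, so their flows preserve `quadX`, `quadP` and `crossXP`. `K_h` and the real and
imaginary parts of `W_h` are linear combinations of these three. Hence every `J_r` and every `R_m`
commutes with every `P_ij` whose indices lie in one group. The flow of `J_r` only turns phases:
`W_h` is an eigenfunction with eigenvalue `-2 i r_h`, so `R_m` is one with eigenvalue `-2 i (r ·
m)`, and `r · m = 0` gives `{J_r, Im R_m} = 0`. Momenta of different groups involve disjoint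
coordinates; within a group involution is part of admissibility.

Independence (`linearIndependent_family`) is seen by testing a linear relation between the
differentials on two kinds of vectors that annihilate the momenta within groups. Rotations with a
separate speed for each group also annihilate every `J_r` and isolate the coefficients of `ℛ`;
hyperbolic scalings move `K_h` at rate `2 Re W_h` and isolate those of the `J_r`. The rest of the
relation splits by group, where admissibility applies. This needs `Re W_h` and `Re R_m` to be
nonzero, which by analyticity is a dense condition once it holds at one point.

For existence (`exists_isAdmissiblePair`), `Z` consists of the Casimirs of a chain of initial
segments and `L` of single momenta inside the smallest segment. A Casimir commutes with every
momentum of its segment, which gives the involutions. The differentials are independent at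
`referencePoint`, and analyticity spreads this to an open dense set. -/

namespace Oscillators

/-! ### Calculus of directional derivatives -/

section DirectionalDerivative

variable {E F : Type*} [NormedAddCommGroup E] [NormedSpace ℝ E] [NormedAddCommGroup F]
  [NormedSpace ℝ F]

/-- `f` is differentiable at `y` and its derivative in the direction `v` is `f'`. -/
def HasDirDeriv (f : E → F) (f' : F) (y v : E) : Prop :=
  DifferentiableAt ℝ f y ∧ fderiv ℝ f y v = f'

variable {y v : E}

theorem HasDirDeriv.congr_deriv {f : E → F} {a b : F} (h : HasDirDeriv f a y v) (hab : a = b) :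
    HasDirDeriv f b y v := hab ▸ h

theorem HasFDerivAt.hasDirDeriv {f : E → F} {f' : E →L[ℝ] F} (h : HasFDerivAt f f' y) :
    HasDirDeriv f (f' v) y v :=
  ⟨h.differentiableAt, by rw [h.fderiv]⟩

theorem ContinuousLinearMap.hasDirDeriv (f : E →L[ℝ] F) : HasDirDeriv f (f v) y v :=
  HasFDerivAt.hasDirDeriv f.hasFDerivAt

theorem HasDirDeriv.clm_comp {G : Type*} [NormedAddCommGroup G] [NormedSpace ℝ G] {f : E → F}
    {f' : F} (L : F →L[ℝ] G) (h : HasDirDeriv f f' y v) :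
    HasDirDeriv (fun y => L (f y)) (L f') y v := by
  obtain ⟨hf, rfl⟩ := h
  exact HasFDerivAt.hasDirDeriv (L.hasFDerivAt.comp y hf.hasFDerivAt)

theorem HasDirDeriv.const (c : F) : HasDirDeriv (fun _ : E => c) 0 y v :=
  HasFDerivAt.hasDirDeriv (hasFDerivAt_const c y)

theorem HasDirDeriv.add {f g : E → F} {f' g' : F} (hf : HasDirDeriv f f' y v)
    (hg : HasDirDeriv g g' y v) : HasDirDeriv (fun y => f y + g y) (f' + g') y v := by
  obtain ⟨hf, rfl⟩ := hf
  obtain ⟨hg, rfl⟩ := hg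
  exact HasFDerivAt.hasDirDeriv (hf.hasFDerivAt.add hg.hasFDerivAt)

theorem HasDirDeriv.sub {f g : E → F} {f' g' : F} (hf : HasDirDeriv f f' y v)
    (hg : HasDirDeriv g g' y v) : HasDirDeriv (fun y => f y - g y) (f' - g') y v := by
  obtain ⟨hf, rfl⟩ := hf
  obtain ⟨hg, rfl⟩ := hg
  exact HasFDerivAt.hasDirDeriv (hf.hasFDerivAt.sub hg.hasFDerivAt)

theorem HasDirDeriv.sum {α : Type*} {s : Finset α} {f : α → E → F} {f' : α → F}
    (h : ∀ a ∈ s, HasDirDeriv (f a) (f' a) y v) :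
    HasDirDeriv (fun y => ∑ a ∈ s, f a y) (∑ a ∈ s, f' a) y v := by
  classical
  induction s using Finset.induction_on with
  | empty => simpa using HasDirDeriv.const (0 : F)
  | insert a s ha ih =>
    simp only [Finset.sum_insert ha]
    exact (h a (by simp)).add (ih fun b hb => h b (by simp [hb]))

variable {A : Type*} [NormedCommRing A] [NormedAlgebra ℝ A]

theorem HasDirDeriv.mul {f g : E → A} {f' g' : A} (hf : HasDirDeriv f f' y v)
    (hg : HasDirDeriv g g' y v) :
    HasDirDeriv (fun y => f y * g y) (f y * g' + f' * g y) y v := by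
  obtain ⟨hf, rfl⟩ := hf
  obtain ⟨hg, rfl⟩ := hg
  refine (HasFDerivAt.hasDirDeriv (hf.hasFDerivAt.mul hg.hasFDerivAt)).congr_deriv ?_
  simp [mul_comm]

theorem HasDirDeriv.const_mul {f : E → A} {f' : A} (c : A) (hf : HasDirDeriv f f' y v) :
    HasDirDeriv (fun y => c * f y) (c * f') y v :=
  ((HasDirDeriv.const c).mul hf).congr_deriv (by simp)

/-- Eigenvalues of a derivation are multiplied under powers and, in `HasDirDeriv.prod_eigen`, added
under products. This gives the rate of change of `R_m` without dividing by `W_h`. -/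
theorem HasDirDeriv.pow_eigen {f : E → A} {c : A} (n : ℕ) (hf : HasDirDeriv f (c * f y) y v) :
    HasDirDeriv (fun y => f y ^ n) ((n * c) * f y ^ n) y v := by
  induction n with
  | zero => simpa using HasDirDeriv.const (1 : A)
  | succ n ih =>
    simp only [pow_succ]
    exact (ih.mul hf).congr_deriv (by push_cast; ring)

theorem HasDirDeriv.prod_eigen {α : Type*} {s : Finset α} {f : α → E → A} {c : α → A}
    (h : ∀ a ∈ s, HasDirDeriv (f a) (c a * f a y) y v) :
    HasDirDeriv (fun y => ∏ a ∈ s, f a y) ((∑ a ∈ s, c a) * ∏ a ∈ s, f a y) y v := by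
  classical
  induction s using Finset.induction_on with
  | empty => simpa using HasDirDeriv.const (1 : A)
  | insert a s ha ih =>
    simp only [Finset.prod_insert ha, Finset.sum_insert ha]
    exact ((h a (by simp)).mul (ih fun b hb => h b (by simp [hb]))).congr_deriv (by ring)

theorem HasDirDeriv.sq {f : E → A} {f' : A} (hf : HasDirDeriv f f' y v) :
    HasDirDeriv (fun y => f y ^ 2) (2 * f y * f') y v := by
  simp only [_root_.sq]
  exact (hf.mul hf).congr_deriv (by ring)

/-- A polynomial in functions with vanishing directional derivatives has vanishing directional
derivative. -/
theorem HasDirDeriv.mvPolynomial_zero {σ : Type*} {f : σ → E → ℝ} (Q : MvPolynomial σ ℝ)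
    (h : ∀ a, HasDirDeriv (f a) 0 y v) :
    HasDirDeriv (fun y => MvPolynomial.eval (fun a => f a y) Q) 0 y v := by
  induction Q using MvPolynomial.induction_on with
  | C a => simpa using HasDirDeriv.const a
  | add p q hp hq => simpa using hp.add hq
  | mul_X p a hp => simpa using hp.mul (h a)

end DirectionalDerivative

/-! ### Analyticity and generic independence -/

section Smoothness

variable {E : Type*} [NormedAddCommGroup E] [NormedSpace ℝ E]

theorem contDiff_mvPolynomial_eval {σ : Type*} {f : σ → E → ℝ} {k : WithTop ℕ∞}
    (Q : MvPolynomial σ ℝ) (h : ∀ a, ContDiff ℝ k (f a)) :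
    ContDiff ℝ k (fun y => MvPolynomial.eval (fun a => f a y) Q) := by
  induction Q using MvPolynomial.induction_on with
  | C a => simpa using contDiff_const
  | add p q hp hq => simpa using hp.add hq
  | mul_X p a hp => simpa using hp.mul (h a)

/-- The nonvanishing set of a nonzero analytic function on a vector space is dense. -/
theorem dense_ne_zero_of_contDiff {f : E → ℝ} (hf : ContDiff ℝ ω f) {y₀ : E} (h₀ : f y₀ ≠ 0) :
    Dense {y | f y ≠ 0} := by
  rw [dense_iff_inter_open]
  rintro V hV ⟨y, hy⟩
  by_contra hne
  have hz : f =ᶠ[nhds y] 0 := by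
    filter_upwards [hV.mem_nhds hy] with w hw
    by_contra hw'
    exact hne ⟨w, hw, hw'⟩
  exact h₀ ((contDiff_omega_iff_analyticOnNhd.1 hf).eqOn_zero_of_preconnected_of_eventuallyEq_zero isPreconnected_univ
    (Set.mem_univ y) hz    (Set.mem_univ y₀))

theorem isOpen_ne_zero_of_contDiff {f : E → ℝ} {k : WithTop ℕ∞} (hf : ContDiff ℝ k f) :
    IsOpen {y | f y ≠ 0} :=
  isOpen_ne_fun hf.continuous continuous_const

/-- Linearly independent functionals on a vector space separate suitable vectors. -/
theorem exists_det_ne_zero_of_linearIndependent {α V : Type*} [Fintype α] [DecidableEq α]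
    [AddCommGroup V] [Module ℝ V] {f : α → V →ₗ[ℝ] ℝ} (hf : LinearIndependent ℝ f) :
    ∃ v : α → V, (Matrix.of fun a b => f a (v b)).det ≠ 0 := by
  have hsurj : Function.Surjective (LinearMap.pi f) := by
    rw [← LinearMap.range_eq_top]
    by_contra hne
    -- A functional that kills a proper range has coordinates which form a nontrivial linear
    -- relation among the `f a`.
    obtain ⟨φ, hφ0, hφ⟩ := Submodule.exists_le_ker_of_lt_top _ (lt_top_iff_ne_top.2 hne)
    have hφ_apply : ∀ w : α → ℝ, φ w = ∑ a, φ (Pi.single a 1) * w a := by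
      intro w
      conv_lhs => rw [← Finset.univ_sum_single w, map_sum]
      refine Finset.sum_congr rfl fun a _ => ?_
      rw [show Pi.single a (w a) = w a • (Pi.single a 1 : α → ℝ) by
        rw [← Pi.single_smul]; simp, map_smul, smul_eq_mul, mul_comm]
    have hz := Fintype.linearIndependent_iff.1 hf (fun a => φ (Pi.single a 1)) (by
      ext x
      have hx : φ (LinearMap.pi f x) = 0 := hφ ⟨x, rfl⟩
      rw [hφ_apply] at hx
      simpa using hx)
    exact hφ0 (LinearMap.ext fun w => by rw [hφ_apply]; simp [hz])
  choose v hv using fun b : α => hsurj (Pi.single b 1)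
  refine ⟨v, ?_⟩
  have : (Matrix.of fun a b => f a (v b)) = 1 := by
    ext a b
    have := congrFun (hv b) a
    simpa [Matrix.one_apply, Pi.single_apply] using this
  simp [this]

/-- Analytic functions with linearly independent differentials at one point are functionally
independent. -/
theorem functionallyIndependent_of_linearIndependent {ι α : Type} [Fintype ι] [Fintype α]
    {F : α → PhaseSpace ι → ℝ} (hF : ∀ a, ContDiff ℝ ω (F a)) {y₀ : PhaseSpace ι}
    (h₀ : LinearIndependent ℝ fun a => fderiv ℝ (F a) y₀) : FunctionallyIndependent F := by
  classical
  obtain ⟨v, hv⟩ := exists_det_ne_zero_of_linearIndependent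
    (f := fun a => (fderiv ℝ (F a) y₀ : PhaseSpace ι →ₗ[ℝ] ℝ))
    (h₀.map' (ContinuousLinearMap.coeLM ℝ) (LinearMap.ker_eq_bot.2
      ContinuousLinearMap.coe_injective))
  -- The test vectors `v` stay fixed while `y` varies, so this Jacobian minor is analytic in `y`;
  -- where it is nonzero the differentials are independent.
  have hdet : ContDiff ℝ ω fun y => (Matrix.of fun a b => fderiv ℝ (F a) y (v b)).det := by
    simp only [Matrix.det_apply, Matrix.of_apply]
    refine ContDiff.sum fun σ _ => ContDiff.const_smul _ (contDiff_prod fun a _ => ?_)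
    exact ((hF _).fderiv_right (m := ω) (by simp)).clm_apply contDiff_const
  refine ⟨_, isOpen_ne_zero_of_contDiff hdet, dense_ne_zero_of_contDiff hdet hv, fun y hy => ?_⟩
  refine Fintype.linearIndependent_iff.2 fun c hc => ?_
  have hc0 : Matrix.vecMul c (Matrix.of fun a b => fderiv ℝ (F a) y (v b)) = 0 := by
    ext b
    have := congrArg (fun T : PhaseSpace ι →L[ℝ] ℝ => T (v b)) hc
    simpa [Matrix.vecMul, dotProduct] using this
  exact congrFun (Matrix.eq_zero_of_vecMul_eq_zero hy hc0)

end Smoothness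
end Oscillators

namespace Oscillators

/-! ### Real coordinates for `w_i` and `P_ij` -/

variable {ι : Type}

/-- The sign `ε_i` as a real number. -/
abbrev realSign (ε : ι → ℤˣ) (i : ι) : ℝ := ((ε i : ℤ) : ℝ)

theorem realSign_sq (ε : ι → ℤˣ) (i : ι) : realSign ε i ^ 2 = 1 := by
  rcases Int.units_eq_one_or (ε i) with h | h <;> simp [realSign, h]

theorem realSign_ne_zero (ε : ι → ℤˣ) (i : ι) : realSign ε i ≠ 0 := by
  rcases Int.units_eq_one_or (ε i) with h | h <;> simp [realSign, h]

theorem zCoord_re (i : ι) (y : PhaseSpace ι) : (zCoord i y).re = y.1 i / Real.sqrt 2 := by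
  simp [zCoord, Complex.div_ofReal_re]

theorem zCoord_im (i : ι) (y : PhaseSpace ι) : (zCoord i y).im = y.2 i / Real.sqrt 2 := by
  simp [zCoord, Complex.div_ofReal_im]

theorem wCoord_re (ε : ι → ℤˣ) (i : ι) (y : PhaseSpace ι) :
    (wCoord ε i y).re = y.1 i / Real.sqrt 2 := by
  unfold wCoord; split_ifs <;> simp [zCoord_re]

theorem wCoord_im (ε : ι → ℤˣ) (i : ι) (y : PhaseSpace ι) :
    (wCoord ε i y).im = realSign ε i * y.2 i / Real.sqrt 2 := by
  rcases Int.units_eq_one_or (ε i) with h | h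
  · simp [wCoord, h, zCoord_im, realSign]
  · have : ¬ ((-1 : ℤˣ) = 1) := by decide
    simp [wCoord, h, zCoord_im, realSign, this, neg_div]

/-- The expression is `-2 Im (w_i conj(w_j))`; the sign `ε` enters only through imaginary parts, and
the two factors `1/√2` cancel the 2. -/
theorem momentum_eq (ε : ι → ℤˣ) (i j : ι) (y : PhaseSpace ι) :
    momentum ε i j y = realSign ε j * (y.1 i * y.2 j) - realSign ε i * (y.2 i * y.1 j) := by
  have h2 : Real.sqrt 2 ^ 2 = 2 := Real.sq_sqrt (by norm_num)
  have h0 : Real.sqrt 2 ≠ 0 := by positivity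
  simp only [momentum, Complex.mul_re, Complex.I_re, Complex.I_im, Complex.sub_im, Complex.mul_im,
    Complex.star_def, Complex.conj_re, Complex.conj_im, wCoord_re, wCoord_im]
  field_simp
  rw [h2]
  ring

/-! ### Invariant quadratic forms -/

section QuadraticForms

/-- The quadratic form `∑ ε_k x_k²` over `S`. -/
def quadX (ε : ι → ℤˣ) (S : Finset ι) (y : PhaseSpace ι) : ℝ := ∑ k ∈ S, realSign ε k * y.1 k ^ 2

/-- The quadratic form `∑ ε_k p_k²` over `S`. -/
def quadP (ε : ι → ℤˣ) (S : Finset ι) (y : PhaseSpace ι) : ℝ := ∑ k ∈ S, realSign ε k * y.2 k ^ 2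

/-- The bilinear form `∑ x_k p_k` over `S`. -/
def crossXP (S : Finset ι) (y : PhaseSpace ι) : ℝ := ∑ k ∈ S, y.1 k * y.2 k

/-- The weight `ε_i` makes the imaginary part free of signs because `ε_i² = 1`. Summed over a group,
this expresses `W_h` through `quadX`, `quadP` and `crossXP`. -/
theorem wCoord_sq (ε : ι → ℤˣ) (i : ι) (y : PhaseSpace ι) :
    ((ε i : ℤ) : ℂ) * wCoord ε i y ^ 2 =
      (((realSign ε i * y.1 i ^ 2 - realSign ε i * y.2 i ^ 2) / 2 : ℝ) : ℂ) +
        ((y.1 i * y.2 i : ℝ) : ℂ) * Complex.I := by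
  have h2 : Real.sqrt 2 ^ 2 = 2 := Real.sq_sqrt (by norm_num)
  have h0 : Real.sqrt 2 ≠ 0 := by positivity
  have hε := realSign_sq ε i
  have hcast : ((ε i : ℤ) : ℂ) = ((realSign ε i : ℝ) : ℂ) := by simp
  rw [hcast]
  apply Complex.ext
  · simp only [pow_two (wCoord ε i y), Complex.mul_re, wCoord_re, wCoord_im,
      Complex.add_re, Complex.ofReal_re, Complex.I_re, Complex.ofReal_im, Complex.I_im]
    field_simp
    rw [h2, hε]
    ring
  · simp only [pow_two (wCoord ε i y), Complex.mul_im, wCoord_re, wCoord_im,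
      Complex.add_im, Complex.ofReal_re, Complex.I_re, Complex.ofReal_im, Complex.I_im]
    field_simp
    rw [h2]
    linear_combination (2 * y.1 i * y.2 i) * hε

variable [Fintype ι]

theorem hasDirDeriv_x (k : ι) (y v : PhaseSpace ι) :
    HasDirDeriv (fun y : PhaseSpace ι => y.1 k) (v.1 k) y v :=
  ContinuousLinearMap.hasDirDeriv
    ((ContinuousLinearMap.proj k).comp (ContinuousLinearMap.fst ℝ (ι → ℝ) (ι → ℝ)))

theorem hasDirDeriv_p (k : ι) (y v : PhaseSpace ι) :
    HasDirDeriv (fun y : PhaseSpace ι => y.2 k) (v.2 k) y v :=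
  ContinuousLinearMap.hasDirDeriv
    ((ContinuousLinearMap.proj k).comp (ContinuousLinearMap.snd ℝ (ι → ℝ) (ι → ℝ)))

theorem hasDirDeriv_momentum (ε : ι → ℤˣ) (i j : ι) (y v : PhaseSpace ι) :
    HasDirDeriv (momentum ε i j) (realSign ε j * (y.1 i * v.2 j + v.1 i * y.2 j) -
      realSign ε i * (y.2 i * v.1 j + v.2 i * y.1 j)) y v := by
  rw [funext (momentum_eq ε i j)]
  exact (((hasDirDeriv_x i y v).mul (hasDirDeriv_p j y v)).const_mul _).sub
    (((hasDirDeriv_p i y v).mul (hasDirDeriv_x j y v)).const_mul _)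

theorem hasDirDeriv_quadX (ε : ι → ℤˣ) (S : Finset ι) (y v : PhaseSpace ι) :
    HasDirDeriv (quadX ε S) (∑ k ∈ S, realSign ε k * (2 * y.1 k * v.1 k)) y v :=
  HasDirDeriv.sum fun k _ => ((hasDirDeriv_x k y v).sq).const_mul _

theorem hasDirDeriv_quadP (ε : ι → ℤˣ) (S : Finset ι) (y v : PhaseSpace ι) :
    HasDirDeriv (quadP ε S) (∑ k ∈ S, realSign ε k * (2 * y.2 k * v.2 k)) y v :=
  HasDirDeriv.sum fun k _ => ((hasDirDeriv_p k y v).sq).const_mul _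

theorem hasDirDeriv_crossXP (S : Finset ι) (y v : PhaseSpace ι) :
    HasDirDeriv (crossXP S) (∑ k ∈ S, (y.1 k * v.2 k + v.1 k * y.2 k)) y v :=
  HasDirDeriv.sum fun k _ => (hasDirDeriv_x k y v).mul (hasDirDeriv_p k y v)

theorem contDiff_momentum (ε : ι → ℤˣ) (i j : ι) {k : WithTop ℕ∞} :
    ContDiff ℝ k (momentum ε i j) := by
  rw [funext (momentum_eq ε i j)]
  fun_prop

theorem contDiff_evalMomenta (ε : ι → ℤˣ) {κ : Type} [LinearOrder κ] (e : κ → ι)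
    (Q : MvPolynomial (Pairs κ) ℝ) {k : WithTop ℕ∞} : ContDiff ℝ k (evalMomenta ε e Q) :=
  contDiff_mvPolynomial_eval Q fun _ => contDiff_momentum ε _ _

end QuadraticForms

/-! ### Hamiltonian fields and flows of the momenta -/

section PoissonBracket

variable [Fintype ι] [DecidableEq ι]

/-- The Hamiltonian vector field of `f`. -/
noncomputable def hamiltonianField (f : PhaseSpace ι → ℝ) (y : PhaseSpace ι) : PhaseSpace ι :=
  (fun i => partialP i f y, fun i => -partialX i f y)

theorem clm_apply_eq_sum (T : PhaseSpace ι →L[ℝ] ℝ) (v : PhaseSpace ι) :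
    T v = ∑ i, (v.1 i * T (Pi.single i 1, 0) + v.2 i * T (0, Pi.single i 1)) := by
  have hv : v = ∑ i, (v.1 i • ((Pi.single i 1, 0) : PhaseSpace ι) +
      v.2 i • ((0, Pi.single i 1) : PhaseSpace ι)) := by
    ext k <;> simp [Prod.fst_sum, Prod.snd_sum, Finset.sum_apply, Pi.single_apply]
  conv_lhs => rw [hv]
  simp only [map_sum, map_add, map_smul, smul_eq_mul]

theorem poissonBracket_eq_fderiv (f g : PhaseSpace ι → ℝ) (y : PhaseSpace ι) :
    poissonBracket f g y = fderiv ℝ g y (hamiltonianField f y) := by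
  rw [clm_apply_eq_sum]
  refine Finset.sum_congr rfl fun i _ => ?_
  simp only [hamiltonianField, partialX, partialP]
  ring

theorem poissonBracket_swap (f g : PhaseSpace ι → ℝ) (y : PhaseSpace ι) :
    poissonBracket f g y = -poissonBracket g f y := by
  unfold poissonBracket
  rw [← Finset.sum_neg_distrib]
  exact Finset.sum_congr rfl fun i _ => by ring

theorem poissonBracket_of_hasDirDeriv {f g : PhaseSpace ι → ℝ} {y : PhaseSpace ι} {c : ℝ}
    (h : HasDirDeriv g c y (hamiltonianField f y)) : poissonBracket f g y = c := by
  rw [poissonBracket_eq_fderiv, h.2]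

theorem hamiltonianField_eq {f : PhaseSpace ι → ℝ} {y : PhaseSpace ι} {dx dp : ι → ℝ}
    (hx : ∀ k, HasDirDeriv f (-dp k) y (Pi.single k 1, 0))
    (hp : ∀ k, HasDirDeriv f (dx k) y (0, Pi.single k 1)) :
    hamiltonianField f y = (dx, dp) := by
  ext k
  · exact (hp k).2
  · simp only [hamiltonianField, partialX, (hx k).2, neg_neg]

/-- The Hamiltonian vector field of `P_ij`. -/
def momentumField (ε : ι → ℤˣ) (i j : ι) (y : PhaseSpace ι) : PhaseSpace ι :=
  (Pi.single j (realSign ε j * y.1 i) - Pi.single i (realSign ε i * y.1 j),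
    Pi.single j (realSign ε i * y.2 i) - Pi.single i (realSign ε j * y.2 j))

theorem hamiltonianField_momentum (ε : ι → ℤˣ) (i j : ι) (y : PhaseSpace ι) :
    hamiltonianField (momentum ε i j) y = momentumField ε i j y := by
  refine hamiltonianField_eq (fun k => (hasDirDeriv_momentum ε i j y _).congr_deriv ?_)
    fun k => (hasDirDeriv_momentum ε i j y _).congr_deriv ?_ <;>
  · simp only [Pi.single_apply, Pi.sub_apply, Pi.zero_apply, eq_comm (a := k)]
    split_ifs <;> ring

variable {ε : ι → ℤˣ} {S : Finset ι} {i j : ι}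

/-- If both indices lie in `S`, the field is an infinitesimal rotation or boost preserving the form;
if neither does, no variable of the form moves. The same holds for the next two invariants. -/
theorem hasDirDeriv_quadX_momentumField (h : i ∈ S ↔ j ∈ S) (y : PhaseSpace ι) :
    HasDirDeriv (quadX ε S) 0 y (momentumField ε i j y) := by
  refine (hasDirDeriv_quadX ε S y _).congr_deriv ?_
  simp only [momentumField, Pi.sub_apply, mul_sub, Finset.sum_sub_distrib, Pi.single_apply,
    mul_ite, mul_zero, Finset.sum_ite_eq', h]
  split_ifs
  · linear_combination 2 * y.1 j * y.1 i * realSign_sq ε j - 2 * y.1 j * y.1 i * realSign_sq ε i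
  · ring

theorem hasDirDeriv_quadP_momentumField (h : i ∈ S ↔ j ∈ S) (y : PhaseSpace ι) :
    HasDirDeriv (quadP ε S) 0 y (momentumField ε i j y) := by
  refine (hasDirDeriv_quadP ε S y _).congr_deriv ?_
  simp only [momentumField, Pi.sub_apply, mul_sub, Finset.sum_sub_distrib, Pi.single_apply,
    mul_ite, mul_zero, Finset.sum_ite_eq', h]
  split_ifs <;> ring

theorem hasDirDeriv_crossXP_momentumField (h : i ∈ S ↔ j ∈ S) (y : PhaseSpace ι) :
    HasDirDeriv (crossXP S) 0 y (momentumField ε i j y) := by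
  refine (hasDirDeriv_crossXP S y _).congr_deriv ?_
  simp only [momentumField, Pi.sub_apply, mul_sub, sub_mul, Finset.sum_sub_distrib,
    Finset.sum_add_distrib, Pi.single_apply, ite_mul, zero_mul,
    mul_ite, mul_zero, Finset.sum_ite_eq', h]
  split_ifs <;> ring

end PoissonBracket

/-! ### Casimir polynomials -/

section Casimir

variable {κ : Type} [Fintype κ] [LinearOrder κ]

theorem sum_pairs_of_symm {f : κ → κ → ℝ} (hsymm : ∀ i j, f i j = f j i) (hdiag : ∀ i, f i i = 0) :
    2 * ∑ ij : Pairs κ, f ij.1.1 ij.1.2 = ∑ i, ∑ j, f i j := by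
  have h1 : ∑ ij : Pairs κ, f ij.1.1 ij.1.2 = ∑ i, ∑ j, if i < j then f i j else 0 := by
    rw [← Fintype.sum_prod_type' (f := fun i j : κ => if i < j then f i j else 0),
      ← Finset.sum_filter]
    exact (Finset.sum_subtype (Finset.univ.filter fun ij : κ × κ => ij.1 < ij.2) (by simp)
      fun ij => f ij.1 ij.2).symm
  have h2 : (∑ i, ∑ j, if i < j then f i j else 0) = ∑ i, ∑ j, if j < i then f i j else 0 := by
    rw [Finset.sum_comm]
    exact Finset.sum_congr rfl fun i _ => Finset.sum_congr rfl fun j _ => by rw [hsymm]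
  rw [two_mul, h1]
  nth_rewrite 2 [h2]
  rw [← Finset.sum_add_distrib]
  refine Finset.sum_congr rfl fun i _ => ?_
  rw [← Finset.sum_add_distrib]
  refine Finset.sum_congr rfl fun j _ => ?_
  rcases lt_trichotomy i j with h | rfl | h
  · simp [h, h.not_gt]
  · simp [hdiag]
  · simp [h, h.not_gt]

/-- The quadratic Casimir polynomial `∑ ε_i ε_j P_ij²` of the indices in `S`. -/
noncomputable def casimir (ε : κ → ℤˣ) (S : Finset κ) : MvPolynomial (Pairs κ) ℝ :=
  ∑ ij : Pairs κ, if ij.1.1 ∈ S ∧ ij.1.2 ∈ S then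
    MvPolynomial.C (realSign ε ij.1.1 * realSign ε ij.1.2) * MvPolynomial.X ij ^ 2 else 0

theorem totalDegree_casimir (ε : κ → ℤˣ) (S : Finset κ) : (casimir ε S).totalDegree ≤ 2 := by
  refine MvPolynomial.totalDegree_finsetSum_le fun ij _ => ?_
  split_ifs
  · refine (MvPolynomial.totalDegree_mul _ _).trans ?_
    rw [MvPolynomial.totalDegree_C, zero_add]
    exact (MvPolynomial.totalDegree_pow _ _).trans (by simp)
  · simp

theorem evalMomenta_casimir (ε : κ → ℤˣ) (S : Finset κ) (y : PhaseSpace κ) :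
    evalMomenta ε id (casimir ε S) y = ∑ ij : Pairs κ, if ij.1.1 ∈ S ∧ ij.1.2 ∈ S then
      realSign ε ij.1.1 * realSign ε ij.1.2 * momentum ε ij.1.1 ij.1.2 y ^ 2 else 0 := by
  simp only [evalMomenta, casimir, map_sum]
  refine Finset.sum_congr rfl fun ij _ => ?_
  split_ifs <;> simp

/-- Lagrange's identity for the Casimir polynomial. -/
theorem evalMomenta_casimir_eq_quad (ε : κ → ℤˣ) (S : Finset κ) (y : PhaseSpace κ) :
    evalMomenta ε id (casimir ε S) y = quadX ε S y * quadP ε S y - crossXP S y * crossXP S y := by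
  -- The right-hand side is the Gram determinant of `x` and `(ε_k p_k)` for the form `∑ ε_k x_k²`.
  -- Passing from pairs `i < j` to all `(i, j)` lets the double sum factor.
  have h := sum_pairs_of_symm (f := fun i j : κ => if i ∈ S ∧ j ∈ S then
      realSign ε i * realSign ε j * momentum ε i j y ^ 2 else 0)
    (fun i j => by
      simp only [and_comm (a := i ∈ S), momentum_eq]
      split_ifs <;> ring)
    (fun i => by simp only [momentum_eq]; split_ifs <;> ring)
  rw [evalMomenta_casimir]
  suffices hs : (∑ i, ∑ j, if i ∈ S ∧ j ∈ S then
      realSign ε i * realSign ε j * momentum ε i j y ^ 2 else 0) =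
      2 * (quadX ε S y * quadP ε S y - crossXP S y * crossXP S y) by linarith
  simp only [ite_and, Finset.sum_ite_irrel, Finset.sum_const_zero, Finset.sum_ite_mem,
    Finset.univ_inter]
  have hterm : ∀ i j, realSign ε i * realSign ε j * momentum ε i j y ^ 2 =
      (realSign ε i * y.1 i ^ 2) * (realSign ε j * y.2 j ^ 2) +
      (realSign ε i * y.2 i ^ 2) * (realSign ε j * y.1 j ^ 2) -
      2 * ((y.1 i * y.2 i) * (y.1 j * y.2 j)) := by
    intro i j
    rw [momentum_eq]
    have hi := realSign_sq ε i
    have hj := realSign_sq ε j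
    linear_combination
      (realSign ε i * realSign ε j * y.1 i ^ 2 * y.2 j ^ 2 - 2 * y.1 i * y.2 i * y.1 j * y.2 j) * hj
      + (realSign ε i * realSign ε j * y.2 i ^ 2 * y.1 j ^ 2
        - 2 * y.1 i * y.2 i * y.1 j * y.2 j * realSign ε j ^ 2) * hi
  simp only [hterm, Finset.sum_sub_distrib, Finset.sum_add_distrib, ← Finset.mul_sum,
    ← Finset.sum_mul]
  simp only [quadX, quadP, crossXP]
  ring

theorem hasDirDeriv_casimir_momentumField {ε : κ → ℤˣ} {S : Finset κ} {i j : κ} (hi : i ∈ S)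
    (hj : j ∈ S) (y : PhaseSpace κ) :
    HasDirDeriv (evalMomenta ε id (casimir ε S)) 0 y (momentumField ε i j y) := by
  rw [funext (evalMomenta_casimir_eq_quad ε S)]
  have hij : i ∈ S ↔ j ∈ S := by simp [hi, hj]
  exact (((hasDirDeriv_quadX_momentumField hij y).mul
    (hasDirDeriv_quadP_momentumField hij y)).sub ((hasDirDeriv_crossXP_momentumField hij y).mul
    (hasDirDeriv_crossXP_momentumField hij y))).congr_deriv (by ring)

/-- Antisymmetry of the bracket replaces the field of the Casimir by the explicit field of the
momentum. -/
theorem hasDirDeriv_momentum_casimirField {ε : κ → ℤˣ} {S : Finset κ} {i j : κ} (hi : i ∈ S)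
    (hj : j ∈ S) (y : PhaseSpace κ) :
    HasDirDeriv (momentum ε i j) 0 y (hamiltonianField (evalMomenta ε id (casimir ε S)) y) := by
  refine ⟨(hasDirDeriv_momentum ε i j y y).1, ?_⟩
  rw [← poissonBracket_eq_fderiv, poissonBracket_swap, poissonBracket_eq_fderiv,
    hamiltonianField_momentum, (hasDirDeriv_casimir_momentumField hi hj y).2, neg_zero]

/-- The Casimir of `T` is built from momenta with indices in `T ⊆ S`, each of which is constant
along the flow of the Casimir of `S`. -/
theorem poissonBracket_casimir_of_subset {ε : κ → ℤˣ} {S T : Finset κ} (h : T ⊆ S) :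
    poissonBracket (evalMomenta ε id (casimir ε S)) (evalMomenta ε id (casimir ε T)) = 0 := by
  funext y
  refine poissonBracket_of_hasDirDeriv ?_
  rw [funext (evalMomenta_casimir ε T)]
  refine (HasDirDeriv.sum (f' := fun _ => 0) fun ij _ => ?_).congr_deriv (by simp)
  split_ifs with hij
  · exact ((hasDirDeriv_momentum_casimirField (h hij.1) (h hij.2) y).sq.const_mul _).congr_deriv
      (by simp)
  · exact HasDirDeriv.const 0

omit [Fintype κ] in
theorem evalMomenta_X (ε : κ → ℤˣ) (ij : Pairs κ) :
    evalMomenta ε id (MvPolynomial.X ij) = momentum ε ij.1.1 ij.1.2 := by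
  funext y
  simp [evalMomenta]

end Casimir

end Oscillators

namespace Oscillators

/-! ### Existence of admissible pairs -/

section Existence

variable {κ : Type} [Fintype κ] [LinearOrder κ]

/-- The point with `p_o = 1`, `x_k = 1` for `k ≠ o` and all other coordinates zero. -/
def referencePoint (o : κ) : PhaseSpace κ :=
  (fun k => if k = o then 0 else 1, fun k => if k = o then 1 else 0)

theorem hasDirDeriv_momentum_referencePoint (ε : κ → ℤˣ) {o i j : κ} (hj : j ≠ o)
    (v : PhaseSpace κ) :
    HasDirDeriv (momentum ε i j) (realSign ε j * ((if i = o then 0 else 1) * v.2 j) -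
      realSign ε i * ((if i = o then 1 else 0) * v.1 j + v.2 i)) (referencePoint o) v := by
  refine (hasDirDeriv_momentum ε i j _ v).congr_deriv ?_
  simp [referencePoint, hj]

/-- To first order in `x_k` at this point only `P_ok` varies: when `i` and `j` both differ from `o`,
`P_ij` has no `x`-derivative since `p_i = p_j = 0`. -/
theorem hasDirDeriv_casimir_referencePoint (ε : κ → ℤˣ) {o k : κ} (ho : ∀ i, o ≤ i) {S : Finset κ}
    (hoS : o ∈ S) (hk : k ≠ o) :
    HasDirDeriv (evalMomenta ε id (casimir ε S))
      (if k ∈ S then 2 * realSign ε o * realSign ε k else 0) (referencePoint o)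
      (Pi.single k 1, 0) := by
  have hok : o < k := lt_of_le_of_ne (ho k) hk.symm
  rw [funext (evalMomenta_casimir ε S)]
  refine (HasDirDeriv.sum (f' := fun ij : Pairs κ => if ij = ⟨(o, k), hok⟩ then
    (if k ∈ S then 2 * realSign ε o * realSign ε k else 0) else 0) fun ij _ => ?_).congr_deriv
      (by simp)
  obtain ⟨⟨i, j⟩, hij : i < j⟩ := ij
  have hj : j ≠ o := ((ho i).trans_lt hij).ne'
  simp only [Subtype.mk.injEq, Prod.mk.injEq]
  by_cases h : i = o ∧ j = k
  · obtain ⟨rfl, rfl⟩ := h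
    simp only [hoS, true_and, and_self, if_true]
    split_ifs
    · refine ((hasDirDeriv_momentum_referencePoint ε hj _).sq.const_mul _).congr_deriv ?_
      simp [momentum_eq, referencePoint, hj]
      linear_combination (2 * realSign ε i * realSign ε j) * realSign_sq ε i
    · exact HasDirDeriv.const 0
  · rw [if_neg h]
    split_ifs
    · refine ((hasDirDeriv_momentum_referencePoint ε hj _).sq.const_mul _).congr_deriv ?_
      rcases not_and_or.1 h with h | h <;> simp [h, Pi.single_apply]
    · exact HasDirDeriv.const 0

/-- The Jacobian is triangular in suitable directions: `x_{t a}` for the Casimirs, from the largest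
`a` down, then `x_{k j}` for `P_{o,k j}` and `p_{k j}` for `P_{k j,l}`. -/
theorem linearIndependent_casimir_momentum (ε : κ → ℤˣ) {z m : ℕ} {o l : κ} {t : Fin z → κ}
    {k : Fin m → κ} {S : Fin z → Finset κ} (ho : ∀ i, o ≤ i) (hoS : ∀ a, o ∈ S a)
    (htS : ∀ a b, t a ∈ S b ↔ a ≤ b) (hk : Function.Injective k) (hok : ∀ j, o < k j)
    (hkl : ∀ j, k j < l) (hol : o < l) (hlt : ∀ a, l ≤ t a) :
    LinearIndependent ℝ fun c => fderiv ℝ (Sum.elim (fun a => evalMomenta ε id (casimir ε (S a)))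
      (Sum.elim (fun j => momentum ε o (k j)) (fun j => momentum ε (k j) l)) c)
      (referencePoint o) := by
  refine Fintype.linearIndependent_iff.2 fun c hc => ?_
  have hv : ∀ v, _ := fun v => congrArg (fun T : PhaseSpace κ →L[ℝ] ℝ => T v) hc
  simp only [Fintype.sum_sum_type, Sum.elim_inl, Sum.elim_inr, add_apply,
    sum_apply, smul_apply, smul_eq_mul,
    zero_apply, (hasDirDeriv_momentum_referencePoint ε (hok _).ne' _).2,
    (hasDirDeriv_momentum_referencePoint ε hol.ne' _).2] at hv
  have hα : ∀ a, c (Sum.inl a) = 0 := by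
    intro a
    induction a using WellFoundedGT.induction with
    | ind a ih =>
      have hta : t a ≠ o := (hol.trans_le (hlt a)).ne'
      have h := hv (Pi.single (t a) 1, 0)
      simp only [(hasDirDeriv_casimir_referencePoint ε ho (hoS _) hta).2, htS] at h
      rw [Finset.sum_eq_single a] at h
      · have hne : ∀ j, k j ≠ t a := fun j => ((hkl j).trans_le (hlt a)).ne
        simpa [hne, (hok _).ne', realSign_ne_zero, Pi.single_apply] using h
      · intro b _ hb
        by_cases hab : a ≤ b
        · simp [ih b (lt_of_le_of_ne hab hb.symm)]
        · simp [hab]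
      · simp
  simp only [hα, zero_mul, Finset.sum_const_zero, zero_add] at hv
  have hβ : ∀ j, c (Sum.inr (Sum.inl j)) = 0 := by
    intro j
    have h := hv (Pi.single (k j) 1, 0)
    simpa [(hok _).ne', Pi.single_apply, hk.eq_iff, realSign_ne_zero] using h
  have hγ : ∀ j, c (Sum.inr (Sum.inr j)) = 0 := by
    intro j
    have h := hv (0, Pi.single (k j) 1)
    simpa [hβ, (hok _).ne', Pi.single_apply, hk.eq_iff, realSign_ne_zero, (hkl j).ne'] using h
  rintro (a | j | j)
  exacts [hα a, hβ j, hγ j]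

theorem exists_isAdmissiblePair (ε : κ → ℤˣ) {z : ℕ}
    (hz : (Fintype.card κ = 1 ∧ z = 0) ∨
      (1 < Fintype.card κ ∧ 1 ≤ z ∧ z ≤ Fintype.card κ - 1)) :
    ∃ (Z : Fin z → MvPolynomial (Pairs κ) ℝ)
      (L : Fin (2 * (Fintype.card κ - z - 1)) → MvPolynomial (Pairs κ) ℝ),
      IsAdmissiblePair ε z Z L := by
  rcases hz with ⟨hq, rfl⟩ | ⟨hq, hz1, hzq⟩
  · have hE : IsEmpty (Fin (2 * (Fintype.card κ - 0 - 1))) := by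
      rw [hq]; exact inferInstanceAs (IsEmpty (Fin 0))
    exact ⟨isEmptyElim, isEmptyElim, isEmptyElim, isEmptyElim,
      ⟨Set.univ, isOpen_univ, dense_univ, fun y _ => linearIndependent_empty_type⟩, isEmptyElim⟩
  set q := Fintype.card κ with hq_def
  let σ : Fin q ≃o κ := Fintype.orderIsoFinOfCardEq κ rfl
  let o : κ := σ ⟨0, by omega⟩
  -- In increasing order, `o` has position 0, the `k j` fill positions `1, …, q-z-1`, and the `t a`
  -- fill `q-z, …, q-1`. Thus `l = t 0`, and the smallest segment contains exactly `o`, the `k j`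
  -- and `l`.
  let l : κ := σ ⟨q - z, by omega⟩
  let t : Fin z → κ := fun a => σ ⟨q - z + a, by omega⟩
  let k : Fin (q - z - 1) → κ := fun j => σ ⟨j + 1, by omega⟩
  let S : Fin z → Finset κ := fun a => Finset.univ.filter fun i => i ≤ t a
  have ho : ∀ i, o ≤ i := fun i => by
    rw [← σ.apply_symm_apply i]
    exact σ.monotone (Fin.mk_le_of_le_val (Nat.zero_le _))
  have htt : ∀ a b, t a ≤ t b ↔ a ≤ b := fun a b => by simp [t]
  have hoS : ∀ a, o ∈ S a := fun a => by simp [S, ho]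
  have htS : ∀ a b, t a ∈ S b ↔ a ≤ b := fun a b => by simp [S, htt]
  have hk : Function.Injective k := fun i j hij => by simpa [k, Fin.ext_iff] using hij
  have hok : ∀ j, o < k j := fun j => by simp [o, k]
  have hkl : ∀ j, k j < l := fun j => by simp only [k, l, OrderIso.lt_iff_lt, Fin.mk_lt_mk]; omega
  have hol : o < l := by simp only [o, l, OrderIso.lt_iff_lt, Fin.mk_lt_mk]; omega
  have hlt : ∀ a, l ≤ t a := fun a => by simp [l, t]
  have hlS : ∀ a, l ∈ S a := fun a => by simp [S, hlt]
  have hkS : ∀ a j, k j ∈ S a := fun a j => by simp [S, (hkl j).le.trans (hlt a)]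
  let e : Fin (2 * (q - z - 1)) ≃ Fin (q - z - 1) ⊕ Fin (q - z - 1) :=
    (finCongr (two_mul _)).trans finSumFinEquiv.symm
  let L : Fin (q - z - 1) ⊕ Fin (q - z - 1) → MvPolynomial (Pairs κ) ℝ :=
    Sum.elim (fun j => MvPolynomial.X ⟨(o, k j), hok j⟩) fun j => MvPolynomial.X ⟨(k j, l), hkl j⟩
  refine ⟨fun a => casimir ε (S a), L ∘ e, fun a => totalDegree_casimir ε _, fun b => ?_, ?_, ?_⟩
  · simp only [Function.comp, L]
    rcases e b with j | j <;> simp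
  · refine functionallyIndependent_of_linearIndependent (y₀ := referencePoint o)
      (fun c => contDiff_evalMomenta ε id _) ?_
    have h := (linearIndependent_casimir_momentum ε ho hoS htS hk hok hkl hol hlt).comp _
      ((Equiv.refl (Fin z)).sumCongr e).injective
    convert h using 1
    funext c
    rcases c with a | b
    · rfl
    · simp only [Function.comp, Equiv.sumCongr_apply, Sum.map_inr, Sum.elim_inr, L]
      rcases e b with j | j <;> simp only [Sum.elim_inl, Sum.elim_inr, evalMomenta_X]
  · rintro a (b | b)
    · rcases le_total b a with h | h
      · exact poissonBracket_casimir_of_subset fun i hi => by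
          simp only [S, Finset.mem_filter, Finset.mem_univ, true_and] at hi ⊢
          exact hi.trans ((htt b a).2 h)
      · funext y
        rw [poissonBracket_swap]
        simp only [Sum.elim_inl]
        rw [poissonBracket_casimir_of_subset fun i hi => by
          simp only [S, Finset.mem_filter, Finset.mem_univ, true_and] at hi ⊢
          exact hi.trans ((htt a b).2 h)]
        simp
    · funext y
      refine poissonBracket_of_hasDirDeriv ?_
      simp only [Function.comp, Sum.elim_inr, L]
      rcases e b with j | j <;> simp only [Sum.elim_inl, Sum.elim_inr, evalMomenta_X]
      · exact hasDirDeriv_momentum_casimirField (hoS a) (hkS a j) y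
      · exact hasDirDeriv_momentum_casimirField (hkS a j) (hlS a) y

end Existence

end Oscillators

namespace Oscillators

/-! ### The functions `K_h`, `W_h`, `J_r`, `R_m` -/

section Groups

variable {n u : ℕ} (ε : Fin n → ℤˣ) (g : Fin n → Fin u)

/-- The fibre of `g` over `h`. -/
def groupFinset (h : Fin u) : Finset (Fin n) := Finset.univ.filter fun i => g i = h

theorem mem_groupFinset {g : Fin n → Fin u} {h : Fin u} {i : Fin n} :
    i ∈ groupFinset g h ↔ g i = h := by simp [groupFinset]

theorem sum_group {M : Type*} [AddCommMonoid M] (h : Fin u) (f : Fin n → M) :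
    ∑ i : Group g h, f i = ∑ i ∈ groupFinset g h, f i :=
  (Finset.sum_subtype (groupFinset g h) (fun _ => mem_groupFinset) f).symm

theorem groupK_eq (h : Fin u) (y : PhaseSpace (Fin n)) :
    groupK ε g h y = 2⁻¹ * (quadX ε (groupFinset g h) y + quadP ε (groupFinset g h) y) := by
  rw [groupK, sum_group g h fun i => ((ε i : ℤ) : ℝ) * action i y, quadX, quadP,
    ← Finset.sum_add_distrib, Finset.mul_sum]
  exact Finset.sum_congr rfl fun i _ => by simp only [action, realSign]; ring

theorem groupW_eq (h : Fin u) (y : PhaseSpace (Fin n)) :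
    groupW ε g h y = Complex.ofRealCLM (2⁻¹ * (quadX ε (groupFinset g h) y -
        quadP ε (groupFinset g h) y)) +
      Complex.I * Complex.ofRealCLM (crossXP (groupFinset g h) y) := by
  rw [groupW, sum_group g h fun i => ((ε i : ℤ) : ℂ) * wCoord ε i y ^ 2, quadX, quadP, crossXP,
    ← Finset.sum_sub_distrib, Finset.mul_sum, map_sum, map_sum, Finset.mul_sum,
    ← Finset.sum_add_distrib]
  refine Finset.sum_congr rfl fun i _ => ?_
  rw [wCoord_sq]
  simp only [Complex.ofRealCLM_apply]
  push_cast
  ring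

theorem groupW_re (h : Fin u) (y : PhaseSpace (Fin n)) :
    (groupW ε g h y).re = 2⁻¹ * (quadX ε (groupFinset g h) y - quadP ε (groupFinset g h) y) := by
  rw [groupW_eq]
  simp

theorem groupJ_eq_linear (r : Fin u → ℤ) (y : PhaseSpace (Fin n)) :
    groupJ ε g r y = linearHamiltonian (fun i => (ε i : ℤ) * r (g i)) y := by
  have : ∀ h, (r h : ℝ) * groupK ε g h y =
      ∑ i ∈ Finset.univ with g i = h, (((ε i : ℤ) * r (g i) : ℤ) : ℝ) * action i y := by
    intro h
    rw [groupK, sum_group g h fun i => ((ε i : ℤ) : ℝ) * action i y, Finset.mul_sum]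
    refine Finset.sum_congr rfl fun i hi => ?_
    rw [mem_groupFinset.1 hi]
    push_cast
    ring
  simp only [groupJ, this]
  exact Finset.sum_fiberwise _ _ _

section Smoothness

variable {k : WithTop ℕ∞} {ι : Type} [Fintype ι]

theorem contDiff_quadX (ε : ι → ℤˣ) (S : Finset ι) : ContDiff ℝ k (quadX ε S) := by
  unfold quadX; fun_prop

theorem contDiff_quadP (ε : ι → ℤˣ) (S : Finset ι) : ContDiff ℝ k (quadP ε S) := by
  unfold quadP; fun_prop

theorem contDiff_crossXP (S : Finset ι) : ContDiff ℝ k (crossXP S) := by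
  unfold crossXP; fun_prop

theorem contDiff_groupJ (r : Fin u → ℤ) : ContDiff ℝ k (groupJ ε g r) := by
  rw [funext (groupJ_eq_linear ε g r)]
  unfold linearHamiltonian action
  fun_prop

theorem contDiff_groupW (h : Fin u) : ContDiff ℝ k (groupW ε g h) := by
  rw [funext (groupW_eq ε g h)]
  exact (Complex.ofRealCLM.contDiff.comp
    (contDiff_const.mul ((contDiff_quadX ε _).sub (contDiff_quadP ε _)))).add
    (contDiff_const.mul (Complex.ofRealCLM.contDiff.comp (contDiff_crossXP _)))

theorem contDiff_groupR (m : Fin u → ℤ) : ContDiff ℝ k (groupR ε g m) := by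
  refine contDiff_prod fun h _ => ?_
  split_ifs
  · exact (contDiff_groupW ε g h).pow _
  · exact (Complex.conjCLE.contDiff.comp (contDiff_groupW ε g h)).pow _

theorem contDiff_groupR_im (m : Fin u → ℤ) : ContDiff ℝ k fun y => (groupR ε g m y).im :=
  Complex.imCLM.contDiff.comp (contDiff_groupR ε g m)

theorem contDiff_groupR_re (m : Fin u → ℤ) : ContDiff ℝ k fun y => (groupR ε g m y).re :=
  Complex.reCLM.contDiff.comp (contDiff_groupR ε g m)

theorem contDiff_groupW_re (h : Fin u) : ContDiff ℝ k fun y => (groupW ε g h y).re :=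
  Complex.reCLM.contDiff.comp (contDiff_groupW ε g h)

end Smoothness

/-! ### Derivatives of the group functions -/

section Derivatives

variable {ε g} {h : Fin u} {y v : PhaseSpace (Fin n)}

theorem hasDirDeriv_groupK {a b : ℝ} (ha : HasDirDeriv (quadX ε (groupFinset g h)) a y v)
    (hb : HasDirDeriv (quadP ε (groupFinset g h)) b y v) :
    HasDirDeriv (groupK ε g h) (2⁻¹ * (a + b)) y v := by
  rw [funext (groupK_eq ε g h)]
  exact (ha.add hb).const_mul _

theorem hasDirDeriv_groupW {a b c : ℝ} (ha : HasDirDeriv (quadX ε (groupFinset g h)) a y v)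
    (hb : HasDirDeriv (quadP ε (groupFinset g h)) b y v)
    (hc : HasDirDeriv (crossXP (groupFinset g h)) c y v) :
    HasDirDeriv (groupW ε g h) ((2⁻¹ * (a - b) : ℝ) + Complex.I * c) y v := by
  rw [funext (groupW_eq ε g h)]
  exact (((ha.sub hb).const_mul _).clm_comp Complex.ofRealCLM).add
    ((hc.clm_comp Complex.ofRealCLM).const_mul _)

theorem hasDirDeriv_groupJ (r : Fin u → ℤ) {a : Fin u → ℝ}
    (ha : ∀ h, HasDirDeriv (groupK ε g h) (a h) y v) :
    HasDirDeriv (groupJ ε g r) (∑ h, r h * a h) y v :=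
  HasDirDeriv.sum fun h _ => (ha h).const_mul _

theorem hasDirDeriv_groupR (m : Fin u → ℤ) {c : Fin u → ℝ}
    (hc : ∀ h, HasDirDeriv (groupW ε g h) (-2 * Complex.I * c h * groupW ε g h y) y v) :
    HasDirDeriv (groupR ε g m) ((∑ h, -2 * Complex.I * (m h * c h)) * groupR ε g m y) y v := by
  refine HasDirDeriv.prod_eigen fun h _ => ?_
  by_cases hm : 0 ≤ m h
  · simp only [hm, if_true]
    refine ((hc h).pow_eigen _).congr_deriv ?_
    have : (((m h).toNat : ℤ) : ℂ) = (m h : ℂ) := by rw [Int.toNat_of_nonneg hm]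
    rw [← this]
    push_cast
    ring
  · simp only [hm, if_false]
    -- Conjugation reverses the sign of the eigenvalue, which compensates for the exponent `-m_h`;
    -- both cases contribute `-2 i m_h c_h`.
    have hstar : HasDirDeriv (fun y => star (groupW ε g h y))
        ((2 * Complex.I * c h) * star (groupW ε g h y)) y v := by
      refine ((hc h).clm_comp (Complex.conjCLE : ℂ →L[ℝ] ℂ)).congr_deriv ?_
      simp [map_ofNat (starRingEnd ℂ) 2]
    refine (hstar.pow_eigen _).congr_deriv ?_
    have : (((-m h).toNat : ℤ) : ℂ) = -(m h : ℂ) := by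
      rw [Int.toNat_of_nonneg (by omega)]; push_cast; ring
    have h2 : (((-m h).toNat : ℕ) : ℂ) = -(m h : ℂ) := by rw [← this]; push_cast; rfl
    rw [h2]
    ring

theorem hasDirDeriv_groupR_im (m : Fin u → ℤ) {c : Fin u → ℝ}
    (hc : ∀ h, HasDirDeriv (groupW ε g h) (-2 * Complex.I * c h * groupW ε g h y) y v) :
    HasDirDeriv (fun y => (groupR ε g m y).im) (-2 * (∑ h, m h * c h) * (groupR ε g m y).re)
      y v := by
  refine ((hasDirDeriv_groupR m hc).clm_comp Complex.imCLM).congr_deriv ?_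
  have : (∑ h, -2 * Complex.I * (m h * c h)) = ((-2 * ∑ h, m h * c h : ℝ) : ℂ) * Complex.I := by
    push_cast
    rw [← Finset.mul_sum]
    ring
  rw [this]
  simp only [Complex.imCLM_apply, Complex.mul_im, Complex.mul_re, Complex.ofReal_re,
    Complex.ofReal_im, Complex.I_re, Complex.I_im]
  ring

theorem hasDirDeriv_evalMomenta_zero {Q : MvPolynomial (Pairs (Group g h)) ℝ}
    (hP : ∀ i j, g i = g j → HasDirDeriv (momentum ε i j) 0 y v) :
    HasDirDeriv (evalMomenta ε (Subtype.val : Group g h → Fin n) Q) 0 y v :=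
  HasDirDeriv.mvPolynomial_zero Q fun ij => hP _ _ (ij.1.1.2.trans ij.1.2.2.symm)

end Derivatives

/-! ### Rotations, scalings and involution -/

section Fields

/-- The infinitesimal rotation of the oscillators of the `h`-th group with speed `c h`. -/
def rotationField (c : Fin u → ℝ) (y : PhaseSpace (Fin n)) : PhaseSpace (Fin n) :=
  (fun i => c (g i) * (realSign ε i * y.2 i), fun i => -(c (g i) * (realSign ε i * y.1 i)))

/-- The infinitesimal hyperbolic scaling of the oscillators of the `h`-th group with speed `c h`. -/
def scalingField (c : Fin u → ℝ) (y : PhaseSpace (Fin n)) : PhaseSpace (Fin n) :=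
  (fun i => c (g i) * y.1 i, fun i => -(c (g i) * y.2 i))

variable {ε g} (c : Fin u → ℝ) (y : PhaseSpace (Fin n))

theorem hasDirDeriv_momentum_rotationField {i j : Fin n} (hij : g i = g j) :
    HasDirDeriv (momentum ε i j) 0 y (rotationField ε g c y) := by
  refine (hasDirDeriv_momentum ε i j y _).congr_deriv ?_
  simp only [rotationField, hij]
  linear_combination c (g j) * y.1 i * y.1 j * realSign_sq ε i
    - c (g j) * y.1 i * y.1 j * realSign_sq ε j

theorem hasDirDeriv_momentum_scalingField {i j : Fin n} (hij : g i = g j) :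
    HasDirDeriv (momentum ε i j) 0 y (scalingField g c y) := by
  refine (hasDirDeriv_momentum ε i j y _).congr_deriv ?_
  simp only [scalingField, hij]
  ring

theorem hasDirDeriv_quadX_rotationField (h : Fin u) :
    HasDirDeriv (quadX ε (groupFinset g h)) (2 * c h * crossXP (groupFinset g h) y) y
      (rotationField ε g c y) := by
  refine (hasDirDeriv_quadX ε _ y _).congr_deriv ?_
  rw [crossXP, Finset.mul_sum]
  refine Finset.sum_congr rfl fun i hi => ?_
  simp only [rotationField, mem_groupFinset.1 hi]
  linear_combination 2 * c h * y.1 i * y.2 i * realSign_sq ε i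

theorem hasDirDeriv_quadP_rotationField (h : Fin u) :
    HasDirDeriv (quadP ε (groupFinset g h)) (-(2 * c h * crossXP (groupFinset g h) y)) y
      (rotationField ε g c y) := by
  refine (hasDirDeriv_quadP ε _ y _).congr_deriv ?_
  rw [crossXP, Finset.mul_sum, ← Finset.sum_neg_distrib]
  refine Finset.sum_congr rfl fun i hi => ?_
  simp only [rotationField, mem_groupFinset.1 hi]
  linear_combination -2 * c h * y.1 i * y.2 i * realSign_sq ε i

theorem hasDirDeriv_crossXP_rotationField (h : Fin u) :
    HasDirDeriv (crossXP (groupFinset g h))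
      (c h * (quadP ε (groupFinset g h) y - quadX ε (groupFinset g h) y)) y
      (rotationField ε g c y) := by
  refine (hasDirDeriv_crossXP _ y _).congr_deriv ?_
  rw [quadX, quadP, ← Finset.sum_sub_distrib, Finset.mul_sum]
  refine Finset.sum_congr rfl fun i hi => ?_
  simp only [rotationField, mem_groupFinset.1 hi]
  ring

theorem hasDirDeriv_groupW_rotationField (h : Fin u) :
    HasDirDeriv (groupW ε g h) (-2 * Complex.I * c h * groupW ε g h y) y
      (rotationField ε g c y) := by
  refine (hasDirDeriv_groupW (hasDirDeriv_quadX_rotationField c y h)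
    (hasDirDeriv_quadP_rotationField c y h)
    (hasDirDeriv_crossXP_rotationField c y h)).congr_deriv ?_
  rw [groupW_eq]
  simp only [Complex.ofRealCLM_apply]
  push_cast
  linear_combination (2 * (c h : ℂ) * crossXP (groupFinset g h) y) * Complex.I_sq

theorem hasDirDeriv_groupJ_rotationField (r : Fin u → ℤ) :
    HasDirDeriv (groupJ ε g r) 0 y (rotationField ε g c y) :=
  (hasDirDeriv_groupJ r fun h => hasDirDeriv_groupK (hasDirDeriv_quadX_rotationField c y h)
    (hasDirDeriv_quadP_rotationField c y h)).congr_deriv (by simp)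

theorem hasDirDeriv_groupK_scalingField (h : Fin u) :
    HasDirDeriv (groupK ε g h) (2 * c h * (groupW ε g h y).re) y (scalingField g c y) := by
  refine (hasDirDeriv_groupK (hasDirDeriv_quadX ε _ y _)
    (hasDirDeriv_quadP ε _ y _)).congr_deriv ?_
  rw [groupW_re, quadX, quadP, ← Finset.sum_sub_distrib, ← Finset.sum_add_distrib, Finset.mul_sum,
    Finset.mul_sum, Finset.mul_sum]
  refine Finset.sum_congr rfl fun i hi => ?_
  simp only [scalingField, mem_groupFinset.1 hi]
  ring

theorem hasDirDeriv_groupJ_scalingField (r : Fin u → ℤ) :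
    HasDirDeriv (groupJ ε g r) (∑ h, r h * (2 * c h * (groupW ε g h y).re)) y
      (scalingField g c y) :=
  hasDirDeriv_groupJ r fun h => hasDirDeriv_groupK_scalingField c y h

/-- This identifies the flow of `J_r` with the rotation of speeds `r_h`, so that its brackets can be
read off from the rotation lemmas. -/
theorem hamiltonianField_groupJ (r : Fin u → ℤ) :
    hamiltonianField (groupJ ε g r) y = rotationField ε g (fun h => r h) y := by
  have hd : ∀ v, HasDirDeriv (groupJ ε g r)
      (∑ h, r h * ∑ i ∈ groupFinset g h, realSign ε i * (y.1 i * v.1 i + y.2 i * v.2 i)) y v := by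
    refine fun v => (hasDirDeriv_groupJ r fun h => hasDirDeriv_groupK (hasDirDeriv_quadX ε _ y v)
      (hasDirDeriv_quadP ε _ y v)).congr_deriv (Finset.sum_congr rfl fun h _ => ?_)
    rw [← Finset.sum_add_distrib, Finset.mul_sum]
    congr 1
    exact Finset.sum_congr rfl fun i _ => by ring
  refine hamiltonianField_eq (fun k => (hd _).congr_deriv ?_) fun k => (hd _).congr_deriv ?_
  · simp [Pi.single_apply, mem_groupFinset]
  · simp [Pi.single_apply, mem_groupFinset]

theorem hasDirDeriv_groupR_im_momentumField {i j : Fin n} (hij : g i = g j) (m : Fin u → ℤ) :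
    HasDirDeriv (fun y => (groupR ε g m y).im) 0 y (momentumField ε i j y) := by
  -- Every `W_h` is invariant, that is, an eigenfunction with eigenvalue zero.
  refine (hasDirDeriv_groupR_im (c := 0) m fun h => ?_).congr_deriv (by simp)
  have hm : i ∈ groupFinset g h ↔ j ∈ groupFinset g h := by simp [mem_groupFinset, hij]
  exact (hasDirDeriv_groupW (hasDirDeriv_quadX_momentumField hm y)
    (hasDirDeriv_quadP_momentumField hm y)
    (hasDirDeriv_crossXP_momentumField hm y)).congr_deriv (by simp)

variable {h : Fin u}

theorem poissonBracket_groupJ_groupJ (r r' : Fin u → ℤ) :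
    poissonBracket (groupJ ε g r) (groupJ ε g r') = 0 := by
  funext y
  refine poissonBracket_of_hasDirDeriv ?_
  rw [hamiltonianField_groupJ]
  exact hasDirDeriv_groupJ_rotationField _ y r'

theorem poissonBracket_groupJ_groupR (r m : Fin u → ℤ) (hrm : ∑ h, r h * m h = 0) :
    poissonBracket (groupJ ε g r) (fun y => (groupR ε g m y).im) = 0 := by
  funext y
  refine poissonBracket_of_hasDirDeriv ?_
  rw [hamiltonianField_groupJ]
  refine (hasDirDeriv_groupR_im m (hasDirDeriv_groupW_rotationField _ y)).congr_deriv ?_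
  have : ∑ h, (m h : ℝ) * r h = 0 := by
    have := congrArg (Int.cast : ℤ → ℝ) hrm
    push_cast at this
    simpa [mul_comm] using this
  simp [this]

theorem poissonBracket_groupJ_evalMomenta (r : Fin u → ℤ)
    (Q : MvPolynomial (Pairs (Group g h)) ℝ) :
    poissonBracket (groupJ ε g r) (evalMomenta ε (Subtype.val : Group g h → Fin n) Q) = 0 := by
  funext y
  refine poissonBracket_of_hasDirDeriv ?_
  rw [hamiltonianField_groupJ]
  exact hasDirDeriv_evalMomenta_zero fun i j => hasDirDeriv_momentum_rotationField _ y

theorem poissonBracket_groupR_evalMomenta (m : Fin u → ℤ)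
    (Q : MvPolynomial (Pairs (Group g h)) ℝ) :
    poissonBracket (fun y => (groupR ε g m y).im)
      (evalMomenta ε (Subtype.val : Group g h → Fin n) Q) = 0 := by
  funext y
  refine poissonBracket_of_hasDirDeriv (hasDirDeriv_evalMomenta_zero fun i j hij => ?_)
  refine ⟨(hasDirDeriv_momentum ε i j y y).1, ?_⟩
  rw [← poissonBracket_eq_fderiv, poissonBracket_swap, poissonBracket_eq_fderiv,
    hamiltonianField_momentum, (hasDirDeriv_groupR_im_momentumField y hij m).2, neg_zero]

end Fields

end Groups

end Oscillators

namespace Oscillators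

/-! ### Reduction to the phase space of one group -/

section Projection

variable {n u : ℕ} (ε : Fin n → ℤˣ) (g : Fin n → Fin u)

/-- The projection of phase space to that of the `h`-th group. -/
noncomputable def groupProj (h : Fin u) : PhaseSpace (Fin n) →L[ℝ] PhaseSpace (Group g h) :=
  (ContinuousLinearMap.pi fun i : Group g h => ContinuousLinearMap.proj i.1).prodMap
    (ContinuousLinearMap.pi fun i : Group g h => ContinuousLinearMap.proj i.1)

/-- The extension by zero from the phase space of the `h`-th group. -/
def groupExt (h : Fin u) (w : PhaseSpace (Group g h)) : PhaseSpace (Fin n) :=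
  (fun i => if hi : g i = h then w.1 ⟨i, hi⟩ else 0,
    fun i => if hi : g i = h then w.2 ⟨i, hi⟩ else 0)

theorem groupProj_groupExt (h : Fin u) (w : PhaseSpace (Group g h)) :
    groupProj g h (groupExt g h w) = w := by
  ext i <;> simp [groupProj, groupExt, i.2]

theorem groupProj_groupExt_of_ne {h h' : Fin u} (hh : h' ≠ h) (w : PhaseSpace (Group g h)) :
    groupProj g h' (groupExt g h w) = 0 := by
  ext i <;> simp [groupProj, groupExt, i.2, hh]

theorem isOpenMap_groupProj (h : Fin u) : IsOpenMap (groupProj g h) :=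
  (groupProj g h).isOpenMap fun w => ⟨_, groupProj_groupExt g h w⟩

variable {h h' : Fin u}

/-- Momenta of a group see only its own coordinates. Differentials are therefore pullbacks along
`groupProj`, which transfers brackets and independence from the small phase space. -/
theorem evalMomenta_eq_comp (Q : MvPolynomial (Pairs (Group g h)) ℝ) :
    evalMomenta ε (Subtype.val : Group g h → Fin n) Q =
      evalMomenta (fun i : Group g h => ε i) id Q ∘ groupProj g h := by
  funext y
  simp only [evalMomenta, momentum_eq, Function.comp]
  rfl

theorem hasFDerivAt_evalMomenta (Q : MvPolynomial (Pairs (Group g h)) ℝ)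
    (y : PhaseSpace (Fin n)) :
    HasFDerivAt (evalMomenta ε (Subtype.val : Group g h → Fin n) Q)
      ((fderiv ℝ (evalMomenta (fun i : Group g h => ε i) id Q) (groupProj g h y)).comp
        (groupProj g h)) y := by
  rw [evalMomenta_eq_comp]
  exact ((contDiff_evalMomenta (k := 1) _ id Q).differentiable one_ne_zero
    (groupProj g h y)).hasFDerivAt.comp y (groupProj g h).hasFDerivAt

theorem fderiv_evalMomenta_apply (Q : MvPolynomial (Pairs (Group g h)) ℝ)
    (y v : PhaseSpace (Fin n)) :
    fderiv ℝ (evalMomenta ε (Subtype.val : Group g h → Fin n) Q) y v =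
      fderiv ℝ (evalMomenta (fun i : Group g h => ε i) id Q) (groupProj g h y)
        (groupProj g h v) := by
  rw [(hasFDerivAt_evalMomenta ε g Q y).fderiv, ContinuousLinearMap.comp_apply]

theorem groupProj_hamiltonianField (Q : MvPolynomial (Pairs (Group g h)) ℝ)
    (y : PhaseSpace (Fin n)) :
    groupProj g h (hamiltonianField (evalMomenta ε (Subtype.val : Group g h → Fin n) Q) y) =
      hamiltonianField (evalMomenta (fun i : Group g h => ε i) id Q) (groupProj g h y) := by
  have h1 : ∀ i : Group g h, groupProj g h (Pi.single i.1 1, 0) = (Pi.single i 1, 0) := by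
    intro i
    ext j <;> simp [groupProj, Pi.single_apply, Subtype.ext_iff]
  have h2 : ∀ i : Group g h, groupProj g h (0, Pi.single i.1 1) = (0, Pi.single i 1) := by
    intro i
    ext j <;> simp [groupProj, Pi.single_apply, Subtype.ext_iff]
  ext i
  · change fderiv ℝ _ y (0, Pi.single i.1 1) = fderiv ℝ _ _ (0, Pi.single i 1)
    rw [fderiv_evalMomenta_apply, h2]
  · change -fderiv ℝ _ y (Pi.single i.1 1, 0) = -fderiv ℝ _ _ (Pi.single i 1, 0)
    rw [fderiv_evalMomenta_apply, h1]

theorem groupProj_hamiltonianField_of_ne (hh : h' ≠ h) (Q : MvPolynomial (Pairs (Group g h)) ℝ)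
    (y : PhaseSpace (Fin n)) :
    groupProj g h' (hamiltonianField (evalMomenta ε (Subtype.val : Group g h → Fin n) Q) y) =
      0 := by
  have h1 : ∀ i : Group g h', groupProj g h (Pi.single i.1 1, 0) = 0 := by
    rintro ⟨i, rfl⟩
    ext ⟨j, hj⟩ <;> simp [groupProj, Pi.single_apply]
    rintro rfl
    exact hh hj
  have h2 : ∀ i : Group g h', groupProj g h (0, Pi.single i.1 1) = 0 := by
    rintro ⟨i, rfl⟩
    ext ⟨j, hj⟩ <;> simp [groupProj, Pi.single_apply]
    rintro rfl
    exact hh hj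
  ext i
  · change fderiv ℝ _ y (0, Pi.single i.1 1) = 0
    rw [fderiv_evalMomenta_apply, h2, map_zero]
  · change -fderiv ℝ _ y (Pi.single i.1 1, 0) = 0
    rw [fderiv_evalMomenta_apply, h1, map_zero, neg_zero]

theorem poissonBracket_evalMomenta (Q Q' : MvPolynomial (Pairs (Group g h)) ℝ)
    (y : PhaseSpace (Fin n)) :
    poissonBracket (evalMomenta ε (Subtype.val : Group g h → Fin n) Q)
      (evalMomenta ε (Subtype.val : Group g h → Fin n) Q') y =
    poissonBracket (evalMomenta (fun i : Group g h => ε i) id Q)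
      (evalMomenta (fun i : Group g h => ε i) id Q') (groupProj g h y) := by
  rw [poissonBracket_eq_fderiv, poissonBracket_eq_fderiv, fderiv_evalMomenta_apply,
    groupProj_hamiltonianField]

theorem poissonBracket_evalMomenta_of_ne (hh : h' ≠ h) (Q : MvPolynomial (Pairs (Group g h)) ℝ)
    (Q' : MvPolynomial (Pairs (Group g h')) ℝ) :
    poissonBracket (evalMomenta ε (Subtype.val : Group g h → Fin n) Q)
      (evalMomenta ε (Subtype.val : Group g h' → Fin n) Q') = 0 := by
  funext y
  rw [poissonBracket_eq_fderiv, fderiv_evalMomenta_apply, groupProj_hamiltonianField_of_ne ε g hh,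
    map_zero, Pi.zero_apply]

end Projection

/-! ### Functional independence of the family -/

section Independence

variable {n u : ℕ} {ε : Fin n → ℤˣ} {g : Fin n → Fin u}

/-- Independence of integer vectors survives extension of scalars to `ℝ`, where the coefficients of
a relation between differentials live. -/
theorem eq_zero_of_sum_mul_intCast_eq_zero {α β : Type*} [Fintype α] [Finite β] {r : α → β → ℤ}
    (hr : LinearIndependent ℤ r) {c : α → ℝ} (hc : ∀ b, ∑ a, c a * r a b = 0) : c = 0 := by
  have hr' : LinearIndependent ℝ fun a => (algebraMap ℤ ℝ) ∘ r a :=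
    linearIndependent_algebraMap_comp_iff.2 hr
  funext a
  refine Fintype.linearIndependent_iff.1 hr' c ?_ a
  funext b
  simpa using hc b

theorem linearIndependent_family {r : Fin u → Fin u → ℤ} (hr : LinearIndependent ℤ r) {k' : ℕ}
    {m : Fin (u - k') → Fin u → ℤ} (hm : LinearIndependent ℤ m) {z : Fin u → ℕ}
    {Z : ∀ h, Fin (z h) → MvPolynomial (Pairs (Group g h)) ℝ}
    {L : ∀ h, Fin (2 * (groupSize g h - z h - 1)) → MvPolynomial (Pairs (Group g h)) ℝ}
    {y : PhaseSpace (Fin n)} (hW : ∀ h, (groupW ε g h y).re ≠ 0)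
    (hR : ∀ j, (groupR ε g (m j) y).re ≠ 0)
    (hZL : ∀ h, LinearIndependent ℝ fun c => fderiv ℝ
      (evalMomenta (fun i : Group g h => ε i) id (Sum.elim (Z h) (L h) c)) (groupProj g h y)) :
    LinearIndependent ℝ fun a => fderiv ℝ
      (Sum.elim (centralFamily ε g r k' z Z) (otherFamily ε g r k' m z L) a) y := by
  refine Fintype.linearIndependent_iff.2 fun c hc => ?_
  have hv : ∀ v, _ := fun v => congrArg (fun T : PhaseSpace (Fin n) →L[ℝ] ℝ => T v) hc
  simp only [Fintype.sum_sum_type, Sum.elim_inl, Sum.elim_inr, add_apply, sum_apply, smul_apply,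
    smul_eq_mul, zero_apply, centralFamily, otherFamily] at hv
  have hP : ∀ {h : Fin u} (Q : MvPolynomial (Pairs (Group g h)) ℝ) (d : Fin u → ℝ),
      fderiv ℝ (evalMomenta ε (Subtype.val : Group g h → Fin n) Q) y (rotationField ε g d y) = 0 :=
    fun Q d => (hasDirDeriv_evalMomenta_zero fun i j =>
      hasDirDeriv_momentum_rotationField d y).2
  have hP' : ∀ {h : Fin u} (Q : MvPolynomial (Pairs (Group g h)) ℝ) (d : Fin u → ℝ),
      fderiv ℝ (evalMomenta ε (Subtype.val : Group g h → Fin n) Q) y (scalingField g d y) = 0 :=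
    fun Q d => (hasDirDeriv_evalMomenta_zero fun i j =>
      hasDirDeriv_momentum_scalingField d y).2
  have hcR : ∀ j, c (Sum.inr (Sum.inr (Sum.inl j))) = 0 := by
    have h0 : (fun j => c (Sum.inr (Sum.inr (Sum.inl j))) * (groupR ε g (m j) y).re) = 0 := by
      refine eq_zero_of_sum_mul_intCast_eq_zero hm fun h => ?_
      -- Rotating only group `h` leaves `-2 ∑ c_j Re(R_{m j}) m_j h = 0`, a relation among the `m
      -- j`.
      have := hv (rotationField ε g (Pi.single h 1) y)
      simp only [hP, (hasDirDeriv_groupJ_rotationField _ y _).2, mul_zero, Finset.sum_const_zero,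
        (hasDirDeriv_groupR_im _ (hasDirDeriv_groupW_rotationField _ y)).2, zero_add,
        add_zero, Pi.single_apply, mul_ite, mul_one, Finset.sum_ite_eq', Finset.mem_univ,
        if_true] at this
      have h2 : (-2 : ℝ) * ∑ j, c (Sum.inr (Sum.inr (Sum.inl j))) * (groupR ε g (m j) y).re *
          m j h = 0 := by
        rw [← this, Finset.mul_sum]
        exact Finset.sum_congr rfl fun j _ => by ring
      linarith
    exact fun j => (mul_eq_zero.1 (congrFun h0 j)).resolve_right (hR j)
  simp only [hcR, zero_mul, Finset.sum_const_zero, zero_add] at hv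
  -- The independence of `r` concerns all of `Fin u`, so `𝒥₁` and `𝒥₂` have to be rejoined.
  let e : {i : Fin u // i.val < k'} ⊕ {i : Fin u // k' ≤ i.val} ≃ Fin u :=
    ((Equiv.refl _).sumCongr (Equiv.subtypeEquivRight fun i => not_lt.symm)).trans
      (Equiv.sumCompl fun i : Fin u => i.val < k')
  have hcJ : ∀ i, Sum.elim (fun i => c (Sum.inl (Sum.inl i)))
      (fun i => c (Sum.inr (Sum.inl i))) i = 0 := by
    refine congrFun (eq_zero_of_sum_mul_intCast_eq_zero (hr.comp e e.injective) fun h => ?_)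
    -- Scaling also changes `ℛ`, whose coefficients are already known to vanish; what is left is `2
    -- Re W_h` times a relation among the `r i`.
    have := hv (scalingField g (Pi.single h 1) y)
    simp only [hP', (hasDirDeriv_groupJ_scalingField _ y _).2, mul_zero, Finset.sum_const_zero,
      add_zero, Pi.single_apply, mul_ite, ite_mul, zero_mul, mul_one, Finset.sum_ite_eq',
      Finset.mem_univ, if_true, ← mul_assoc, ← Finset.sum_mul, ← add_mul] at this
    have := (mul_eq_zero.1 this).resolve_right (hW h)
    rw [Fintype.sum_sum_type]
    have h2 := (mul_eq_zero.1 this).resolve_right two_ne_zero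
    exact h2
  have hcJ1 : ∀ i, c (Sum.inl (Sum.inl i)) = 0 := fun i => hcJ (Sum.inl i)
  have hcJ2 : ∀ i, c (Sum.inr (Sum.inl i)) = 0 := fun i => hcJ (Sum.inr i)
  simp only [hcJ1, hcJ2, zero_mul, Finset.sum_const_zero, zero_add, Fintype.sum_sigma,
    fderiv_evalMomenta_apply] at hv
  have hcP : ∀ h, ∀ a, Sum.elim (fun a => c (Sum.inl (Sum.inr ⟨h, a⟩)))
      (fun b => c (Sum.inr (Sum.inr (Sum.inr ⟨h, b⟩)))) a = 0 := by
    intro h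
    refine Fintype.linearIndependent_iff.1 (hZL h) _ (ContinuousLinearMap.ext fun w => ?_)
    -- Vectors supported in group `h` make the terms of all other groups disappear.
    have := hv (groupExt g h w)
    rw [Finset.sum_eq_single h (fun h' _ hh => by simp [groupProj_groupExt_of_ne g hh])
      (by simp), Finset.sum_eq_single h (fun h' _ hh => by
        simp [groupProj_groupExt_of_ne g hh]) (by simp)] at this
    simp only [groupProj_groupExt] at this
    simpa only [Fintype.sum_sum_type, Sum.elim_inl, Sum.elim_inr, add_apply, sum_apply, smul_apply,
      smul_eq_mul, zero_apply] using this
  rintro ((i | ⟨h, a⟩) | (i | j | ⟨h, b⟩))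
  exacts [hcJ1 i, hcP h (Sum.inl a), hcJ2 i, hcR j, hcP h (Sum.inr b)]

theorem exists_groupW_eq_realSign (ε : Fin n → ℤˣ) (hg : Function.Surjective g) :
    ∃ y : PhaseSpace (Fin n), ∀ h, ∃ w : ℝ, w ≠ 0 ∧ groupW ε g h y = w := by
  let y : PhaseSpace (Fin n) :=
    -- A single oscillator per group is excited, so signs `ε` of opposite kind cannot cancel in
    -- `W_h`; with `p = 0` all `W_h`, hence all `R_m`, are real.
    (fun i => if i = Function.surjInv hg (g i) then 1 else 0, 0)
  refine ⟨y, fun h => ⟨2⁻¹ * realSign ε (Function.surjInv hg h),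
    mul_ne_zero (by norm_num) (realSign_ne_zero _ _), ?_⟩⟩
  have hX : quadX ε (groupFinset g h) y = realSign ε (Function.surjInv hg h) := by
    rw [quadX, Finset.sum_eq_single (Function.surjInv hg h)]
    · simp [y, Function.surjInv_eq hg h]
    · intro i hi hne
      simp [y, mem_groupFinset.1 hi, hne]
    · intro hn
      exact absurd (mem_groupFinset.2 (Function.surjInv_eq hg h)) hn
  rw [groupW_eq, hX]
  simp [quadP, crossXP, y]

theorem functionallyIndependent_family (hg : Function.Surjective g) {r : Fin u → Fin u → ℤ}
    (hr : LinearIndependent ℤ r) {k' : ℕ}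
    {m : Fin (u - k') → Fin u → ℤ} (hm : LinearIndependent ℤ m) {z : Fin u → ℕ}
    {Z : ∀ h, Fin (z h) → MvPolynomial (Pairs (Group g h)) ℝ}
    {L : ∀ h, Fin (2 * (groupSize g h - z h - 1)) → MvPolynomial (Pairs (Group g h)) ℝ}
    (hZL : ∀ h, FunctionallyIndependent fun c =>
      evalMomenta (fun i : Group g h => ε i) id (Sum.elim (Z h) (L h) c)) :
    FunctionallyIndependent
      (Sum.elim (centralFamily ε g r k' z Z) (otherFamily ε g r k' m z L)) := by
  choose U hUo hUd hU using hZL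
  obtain ⟨y₀, hy₀⟩ := exists_groupW_eq_realSign ε hg
  choose w hw0 hw using hy₀
  have hR₀ : ∀ j, (groupR ε g (m j) y₀).re ≠ 0 := by
    intro j
    have : groupR ε g (m j) y₀ = ((∏ h, if 0 ≤ m j h then w h ^ (m j h).toNat
        else w h ^ (-m j h).toNat : ℝ) : ℂ) := by
      rw [groupR, Complex.ofReal_prod]
      refine Finset.prod_congr rfl fun h _ => ?_
      split_ifs <;> simp [hw]
    rw [this, Complex.ofReal_re, Finset.prod_ne_zero_iff]
    intro h _
    split_ifs <;> exact pow_ne_zero _ (hw0 h)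
  have hW₀ : ∀ h, (groupW ε g h y₀).re ≠ 0 := fun h => by simpa [hw] using hw0 h
  refine ⟨(⋂ h, groupProj g h ⁻¹' U h) ∩ ((⋂ j, {y | (groupR ε g (m j) y).re ≠ 0}) ∩
    ⋂ h, {y | (groupW ε g h y).re ≠ 0}), ?_, ?_, ?_⟩
  · exact (isOpen_iInter_of_finite fun h => (hUo h).preimage (groupProj g h).continuous).inter
      ((isOpen_iInter_of_finite fun j => isOpen_ne_zero_of_contDiff (k := 0)
        (contDiff_groupR_re ε g (m j))).inter (isOpen_iInter_of_finite fun h =>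
          isOpen_ne_zero_of_contDiff (k := 0) (contDiff_groupW_re ε g h)))
  · have hRo : IsOpen (⋂ j, {y | (groupR ε g (m j) y).re ≠ 0}) :=
      isOpen_iInter_of_finite fun j => isOpen_ne_zero_of_contDiff (k := 0)
        (contDiff_groupR_re ε g (m j))
    have hWo : IsOpen (⋂ h, {y | (groupW ε g h y).re ≠ 0}) := isOpen_iInter_of_finite fun h =>
      isOpen_ne_zero_of_contDiff (k := 0) (contDiff_groupW_re ε g h)
    refine Dense.inter_of_isOpen_right ?_ (Dense.inter_of_isOpen_right ?_ ?_ hWo)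
      (hRo.inter hWo)
    -- Preimages of dense sets under an open map are dense, and `groupProj` is open because it is a
    -- surjective linear map.
    · exact dense_iInter_of_isOpen (fun h => (hUo h).preimage (groupProj g h).continuous)
        fun h => (hUd h).preimage (isOpenMap_groupProj g h)
    · exact dense_iInter_of_isOpen (fun j => isOpen_ne_zero_of_contDiff (k := 0)
        (contDiff_groupR_re ε g (m j))) fun j =>
          dense_ne_zero_of_contDiff (contDiff_groupR_re ε g (m j)) (hR₀ j)
    · exact dense_iInter_of_isOpen (fun h => isOpen_ne_zero_of_contDiff (k := 0)
        (contDiff_groupW_re ε g h)) fun h =>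
          dense_ne_zero_of_contDiff (contDiff_groupW_re ε g h) (hW₀ h)
  · rintro y ⟨hyU, hyR, hyW⟩
    exact linearIndependent_family hr hm (fun h => Set.mem_iInter.1 hyW h)
      (fun j => Set.mem_iInter.1 hyR j) fun h => hU h _ (Set.mem_iInter.1 hyU h)

end Independence

/-! ### Counting and assembly -/

section Main

variable {n u : ℕ} {ε : Fin n → ℤˣ} {g : Fin n → Fin u}

theorem card_fin_lt {k' : ℕ} (hku : k' ≤ u) : Fintype.card {i : Fin u // i.val < k'} = k' := by
  have e : {i : Fin u // i.val < k'} ≃ Fin k' :=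
    { toFun := fun i => ⟨i.1, i.2⟩
      invFun := fun i => ⟨⟨i, i.2.trans_le hku⟩, i.2⟩
      left_inv := fun _ => rfl
      right_inv := fun _ => rfl }
  simpa using Fintype.card_congr e

theorem card_fin_le {k' : ℕ} (hku : k' ≤ u) :
    Fintype.card {i : Fin u // k' ≤ i.val} = u - k' := by
  have h := Fintype.card_subtype_compl fun i : Fin u => i.val < k'
  rw [card_fin_lt hku, Fintype.card_fin] at h
  rw [← h]
  exact Fintype.card_congr (Equiv.subtypeEquivRight fun i => not_lt.symm)

theorem sum_groupSize (g : Fin n → Fin u) : ∑ h, groupSize g h = n := by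
  rw [← Fintype.card_sigma, Fintype.card_congr (Equiv.sigmaFiberEquiv g), Fintype.card_fin]

theorem isIntegrableSet_family (hg : Function.Surjective g) {z : Fin u → ℕ}
    (hz : ∀ h, z h + 1 ≤ groupSize g h) {k' : ℕ} (hku : k' ≤ u) {r : Fin u → Fin u → ℤ}
    (hr : LinearIndependent ℤ r) {m : Fin (u - k') → Fin u → ℤ} (hm : LinearIndependent ℤ m)
    (hrm : ∀ i : Fin u, i.val < k' → ∀ j, ∑ h, r i h * m j h = 0)
    {Z : ∀ h, Fin (z h) → MvPolynomial (Pairs (Group g h)) ℝ}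
    {L : ∀ h, Fin (2 * (groupSize g h - z h - 1)) → MvPolynomial (Pairs (Group g h)) ℝ}
    (hZL : ∀ h, IsAdmissiblePair (fun i : Group g h => ε i.1) (z h) (Z h) (L h)) :
    IsIntegrableSet (k' + ∑ h, z h) (centralFamily ε g r k' z Z) (otherFamily ε g r k' m z L) where
  card_central := by
    simp only [Fintype.card_sum, Fintype.card_sigma, Fintype.card_fin, card_fin_lt hku]
  card_total := by
    simp only [Fintype.card_sum, Fintype.card_sigma, Fintype.card_fin, card_fin_lt hku,
      card_fin_le hku]
    -- The bound `z h + 1 ≤ groupSize g h` makes the truncated subtraction exact. Summed over the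
    -- groups, the constant 2 gives `2 u`, which matches the `J_r` and `ℛ` together with `k'`.
    have h1 : ∑ h, (2 * (groupSize g h - z h - 1) + 2 * z h + 2) = ∑ h, 2 * groupSize g h :=
      Finset.sum_congr rfl fun h _ => by have := hz h; omega
    simp only [Finset.sum_add_distrib, ← Finset.mul_sum, sum_groupSize, Finset.sum_const,
      Finset.card_univ, Fintype.card_fin, smul_eq_mul] at h1 ⊢
    omega
  smooth := by
    rintro ((i | ⟨h, a⟩) | (i | j | ⟨h, b⟩))
    exacts [contDiff_groupJ ε g _, contDiff_evalMomenta ε _ _, contDiff_groupJ ε g _,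
      contDiff_groupR_im ε g _, contDiff_evalMomenta ε _ _]
  independent := functionallyIndependent_family hg hr hm fun h => (hZL h).independent
  involution := by
    have hQ : ∀ h a (c : Fin (z h) ⊕ Fin (2 * (groupSize g h - z h - 1))),
        poissonBracket (evalMomenta ε (Subtype.val : Group g h → Fin n) (Z h a))
          (evalMomenta ε (Subtype.val : Group g h → Fin n) (Sum.elim (Z h) (L h) c)) = 0 := by
      intro h a c
      funext y
      rw [poissonBracket_evalMomenta]
      have := congrFun ((hZL h).involution a c) (groupProj g h y)
      rw [Pi.zero_apply] at this ⊢
      convert this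
    have hne : ∀ {f f' : PhaseSpace (Fin n) → ℝ}, poissonBracket f f' = 0 →
        poissonBracket f' f = 0 := by
      intro f f' hf
      funext y
      rw [poissonBracket_swap, hf, Pi.zero_apply, neg_zero]
    rintro (i | ⟨h, a⟩) ((i' | ⟨h', a'⟩) | (i' | j | ⟨h', b⟩))
    · exact poissonBracket_groupJ_groupJ _ _
    · exact poissonBracket_groupJ_evalMomenta _ _
    · exact poissonBracket_groupJ_groupJ _ _
    · exact poissonBracket_groupJ_groupR _ _ (hrm _ i.2 j)
    · exact poissonBracket_groupJ_evalMomenta _ _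
    · exact hne (poissonBracket_groupJ_evalMomenta _ _)
    · by_cases hh : h' = h
      · subst hh
        exact hQ h' a (Sum.inl a')
      · exact poissonBracket_evalMomenta_of_ne ε g hh _ _
    · exact hne (poissonBracket_groupJ_evalMomenta _ _)
    · exact hne (poissonBracket_groupR_evalMomenta _ _)
    · by_cases hh : h' = h
      · subst hh
        exact hQ h' a (Sum.inr b)
      · exact poissonBracket_evalMomenta_of_ne ε g hh _ _

end Main

end Oscillators

theorem mainTheorem1 (n u : ℕ) (l : Fin n → ℤ) (ε : Fin n → ℤˣ) (s : Fin u → ℕ)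
    (g : Fin n → Fin u)
    (hs : ∀ h, 0 < s h)
    (hg : Function.Surjective g)
    (hl : ∀ i, l i = (ε i : ℤ) * (s (g i) : ℤ))
    (z : Fin u → ℕ)
    (hz : ∀ h, (Oscillators.groupSize g h = 1 ∧ z h = 0) ∨
      (1 < Oscillators.groupSize g h ∧ 1 ≤ z h ∧ z h ≤ Oscillators.groupSize g h - 1))
    (k' : ℕ) (hk1 : 1 ≤ k') (hku : k' ≤ u)
    (r : Fin u → Fin u → ℤ)
    (hr : LinearIndependent ℤ r)
    (hr1 : r ⟨0, by omega⟩ = fun h => (s h : ℤ))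
    (m : Fin (u - k') → Fin u → ℤ)
    (hm : LinearIndependent ℤ m)
    (hrm : ∀ i : Fin u, i.val < k' → ∀ j, ∑ h, r i h * m j h = 0) :
    -- admissible sets `Z_{q_h,z_h}`, `L_{q_h,z_h}` exist for every group
    (∀ h, ∃ (Z : Fin (z h) → MvPolynomial (Oscillators.Pairs (Oscillators.Group g h)) ℝ)
        (L : Fin (2 * (Oscillators.groupSize g h - z h - 1)) →
          MvPolynomial (Oscillators.Pairs (Oscillators.Group g h)) ℝ),
        Oscillators.IsAdmissiblePair (fun i : Oscillators.Group g h => ε i.1) (z h) Z L) ∧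
    -- and every choice of them gives an integrable set with `k = k' + ∑ z_h`
    ∀ (Z : ∀ h, Fin (z h) → MvPolynomial (Oscillators.Pairs (Oscillators.Group g h)) ℝ)
      (L : ∀ h, Fin (2 * (Oscillators.groupSize g h - z h - 1)) →
        MvPolynomial (Oscillators.Pairs (Oscillators.Group g h)) ℝ),
      (∀ h, Oscillators.IsAdmissiblePair
        (fun i : Oscillators.Group g h => ε i.1) (z h) (Z h) (L h)) →
      Oscillators.IsIntegrableSet (k' + ∑ h, z h)
        (Oscillators.centralFamily ε g r k' z Z)
        (Oscillators.otherFamily ε g r k' m z L) ∧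
      Oscillators.centralFamily ε g r k' z Z (Sum.inl ⟨⟨0, by omega⟩, hk1⟩) =
        Oscillators.linearHamiltonian l := by
  refine ⟨fun h => Oscillators.exists_isAdmissiblePair _ (hz h), fun Z L hZL =>
    ⟨Oscillators.isIntegrableSet_family hg (fun h => ?_) hku hr hm hrm hZL, ?_⟩⟩
  · rcases hz h with h1 | h1 <;> omega
  · funext y
    rw [Oscillators.centralFamily, Sum.elim_inl, Oscillators.groupJ_eq_linear, hr1]
    exact congrArg (fun l => Oscillators.linearHamiltonian l y) (funext fun i => (hl i).symm)
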